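/- For $1\le r<\infty$ put $\varphi_r(t)=e^{t^r}-1$ and, for a random variable $f$ on a probability space, $\|f\|_{L_{\varphi_r}}=\inf\{\varepsilon>0:\ \mathbb E\,\varphi_r(|f|/\varepsilon)\le 1\}$. A complex random variable $\gamma$ is subgaussian with parameter $s\ge 0$ if $\mathbb E\exp(\mathrm{Re}(z\gamma))\le\exp(s^2|z|^2/2)$ for all $z\in\mathbb C$ (for real $\gamma$ this is equivalent to $\mathbb E\exp(x\gamma)\le\exp(s^2x^2/2)$ for all $x\in\mathbb R$). For $\mathfrak p=(p_1,\dots,p_m)\in[1,\infty]^m$ let $r(\mathfrak p)=\min_{1\le k\le m}\max\{2,p_k'\}$, where $\frac1{p_k}+\frac1{p_k'}=1$. Let $\mathbb K=\mathbb R$ or $\mathbb C$, let $\ell_p^n$ be $\mathbb K^n$ with the $\ell_p$-norm, $B_{\ell_p^n}$ its closed unit ball, and $\mathfrak J=\prod_{j=1}^m\{1,\dots,n_j\}$. **Theorem.** (1) For all $r\in[2,\infty)$ and $s,M\ge0$ there is a constant $C>0$, depending only on $r$ and $s$ and, if $r>2$, on $M$, such that the following holds. Let $\mathfrak p=(p_1,\dots,p_m)\in[1,\infty]^m$,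 not all $p_j$ equal to $1$, with $r(\mathfrak p)=r$, let $n_1,\dots,n_m\ge1$, let $(c_{\mathfrak j})_{\mathfrak j\in\mathfrak J}$ be scalars and let $(\gamma_{\mathfrak j})_{\mathfrak j\in\mathfrak J}$ be independent (real or complex) random variables, subgaussian with parameter $s$, and, if $r>2$, such that $|\gamma_{\mathfrak j}|\le M$ almost surely for all $\mathfrak j$. Then $$\Big\|\sup_{z_i\in B_{\ell_{p_i}^{n_i}},\,1\le i\le m}\Big|\sum_{\mathfrak j\in\mathfrak J}\gamma_{\mathfrak j}c_{\mathfrak j}z_1(j_1)\cdots z_m(j_m)\Big|\Big\|_{L_{\varphi_r}}\le C\,(1+\log m)^{1/r}\sup_{\mathfrak j\in\mathfrak J}|c_{\mathfrak j}|\Big(\sum_{j=1}^m n_j\Big)^{1/r}\prod_{j=1}^m n_j^{\max\{\frac12-\frac1{p_j},0\}} .$$ (2) This is asymptotically optimal in $n$ when $n_1=\dots=n_m=n$: for every $m$ and $\mathfrak p\in[1,\infty]^m$ with not all $p_j$ equal to $1$ there are constants $A,B>0$, depending only on $m$ and $\mathfrak p$, such that for all $n\ge1$, all scalars with $|c_{\mathfrak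 j}|=1$, and all independent $(\gamma_{\mathfrak j})$, each of them a Rademacher or a Steinhaus variable or, in case $r(\mathfrak p)=2$, possibly a (real or complex) normal Gaussian variable, $$A\,n^{\frac1{r(\mathfrak p)}+\sum_{j}\max\{\frac12-\frac1{p_j},0\}}\le\Big\|\sup_{z_i\in B_{\ell_{p_i}^{n}}}\Big|\sum_{\mathfrak j}\gamma_{\mathfrak j}c_{\mathfrak j}z_1(j_1)\cdots z_m(j_m)\Big|\Big\|_{L_{\varphi_{r(\mathfrak p)}}}\le B\,n^{\frac1{r(\mathfrak p)}+\sum_{j}\max\{\frac12-\frac1{p_j},0\}} .$$ -/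

import Mathlib

open MeasureTheory ProbabilityTheory
open scoped ENNReal

/-- A complex random variable `f` is subgaussian with parameter `s`, that is `sg(f) ≤ s`:
`𝔼 exp (Re (z f)) ≤ exp (s² |z|² / 2)` for every complex number `z`. -/
def IsSubgaussianWith {Ω : Type*} [MeasurableSpace Ω] (f : Ω → ℂ) (s : ℝ) (μ : Measure Ω) : Prop :=
  ∀ z : ℂ, Integrable (fun ω => Real.exp (z * f ω).re) μ ∧
    ∫ ω, Real.exp (z * f ω).re ∂μ ≤ Real.exp (s ^ 2 * ‖z‖ ^ 2 / 2)

/-- For a real random variable, `IsSubgaussianWith` is the usual real definition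
`𝔼 exp (x f) ≤ exp (s² x² / 2)` for every real `x`. -/
theorem isSubgaussianWith_ofReal_iff {Ω : Type*} [MeasurableSpace Ω] (f : Ω → ℝ) (s : ℝ)
    (μ : Measure Ω) :
    IsSubgaussianWith (fun ω => (f ω : ℂ)) s μ ↔
      ∀ x : ℝ, Integrable (fun ω => Real.exp (x * f ω)) μ ∧
        ∫ ω, Real.exp (x * f ω) ∂μ ≤ Real.exp (s ^ 2 * x ^ 2 / 2) := by
  constructor
  · intro h x
    simpa using h x
  · intro h z
    have hz := h z.re
    simp only [Complex.re_mul_ofReal]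
    refine ⟨hz.1, hz.2.trans (Real.exp_le_exp.mpr ?_)⟩
    have h1 : z.re ^ 2 ≤ ‖z‖ ^ 2 := by
      rw [← sq_abs z.re]
      exact pow_le_pow_left₀ (abs_nonneg _) (Complex.abs_re_le_norm z) 2
    have h2 := mul_le_mul_of_nonneg_left h1 (sq_nonneg s)
    linarith

/-- The Orlicz (Luxemburg) norm `inf {ε > 0 : ∫ φ (|f| / ε) ∂μ ≤ 1}`, with value `∞` if there is no
such `ε`. -/
noncomputable def luxemburgNorm {Ω : Type*} [MeasurableSpace Ω] (φ : ℝ → ℝ) (μ : Measure Ω)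
    (f : Ω → ℝ) : ℝ≥0∞ :=
  ⨅ (ε : ℝ) (_ : 0 < ε ∧ ∫⁻ ω, ENNReal.ofReal (φ (|f ω| / ε)) ∂μ ≤ 1), ENNReal.ofReal ε

/-- The exponential Orlicz function `φ_r (t) = exp (t ^ r) - 1`. -/
noncomputable def expOrlicz (r t : ℝ) : ℝ := Real.exp (t ^ r) - 1

/-- The conjugate exponent `p'`, `1 / p + 1 / p' = 1`, for `p ∈ [1, ∞]`. -/
noncomputable def conjExp (p : ℝ≥0∞) : ℝ≥0∞ := (1 - p⁻¹)⁻¹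

/-- `r(p) = min {max {2, p_k'} : 1 ≤ k ≤ m} ∈ [2, ∞]`. -/
noncomputable def rExp {m : ℕ} (p : Fin m → ℝ≥0∞) : ℝ≥0∞ := ⨅ k, max 2 (conjExp (p k))

/-- `max {1 / 2 - 1 / p, 0}`, where `1 / ∞ = 0`. -/
noncomputable def dimExp (p : ℝ≥0∞) : ℝ := max (1 / 2 - (p⁻¹).toReal) 0

/-- The value `∑_j a_j z_1(j_1) ⋯ z_m(j_m)` at `z ∈ ℓ_{p_1}^{n_1} × ⋯ × ℓ_{p_m}^{n_m}` of the
`m`-linear form with coefficients `a`. The spaces are over `𝕂 = ℝ` or `𝕂 = ℂ`, and `RCLike.map 𝕂 ℂ`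
is the inclusion of `𝕂` in `ℂ`. -/
noncomputable def formValue (𝕂 : Type*) [RCLike 𝕂] {m : ℕ} {n : Fin m → ℕ} (p : Fin m → ℝ≥0∞)
    (a : (∀ i, Fin (n i)) → ℂ) (z : ∀ i, PiLp (p i) (fun _ : Fin (n i) => 𝕂)) : ℂ :=
  ∑ j : (∀ i, Fin (n i)), a j * ∏ i, RCLike.map 𝕂 ℂ (z i (j i))

/-- The supremum of `|∑_j a_j z_1(j_1) ⋯ z_m(j_m)|` over the product of the closed unit balls of
`ℓ_{p_1}^{n_1}, …, ℓ_{p_m}^{n_m}`, spaces over `𝕂`. -/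
noncomputable def formNorm (𝕂 : Type*) [RCLike 𝕂] {m : ℕ} {n : Fin m → ℕ} (p : Fin m → ℝ≥0∞)
    (a : (∀ i, Fin (n i)) → ℂ) : ℝ :=
  ⨆ z : {z : ∀ i, PiLp (p i) (fun _ : Fin (n i) => 𝕂) // ∀ i, ‖z i‖ ≤ 1}, ‖formValue 𝕂 p a z.1‖

theorem norm_rclike_map_le {𝕂 : Type*} [RCLike 𝕂] (x : 𝕂) : ‖RCLike.map 𝕂 ℂ x‖ ≤ ‖x‖ := by
  have h : ‖RCLike.map 𝕂 ℂ x‖ ^ 2 = ‖x‖ ^ 2 := by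
    rw [RCLike.norm_sq_eq_def, RCLike.norm_sq_eq_def]
    simp [RCLike.map_apply]
  exact (pow_left_inj₀ (norm_nonneg _) (norm_nonneg _) two_ne_zero).mp h |>.le

/-- The supremum in `formNorm` is finite. -/
theorem bddAbove_formValue (𝕂 : Type*) [RCLike 𝕂] {m : ℕ} {n : Fin m → ℕ} (p : Fin m → ℝ≥0∞)
    (hp : ∀ i, 1 ≤ p i) (a : (∀ i, Fin (n i)) → ℂ) :
    BddAbove (Set.range fun z : {z : ∀ i, PiLp (p i) (fun _ : Fin (n i) => 𝕂) //
      ∀ i, ‖z i‖ ≤ 1} => ‖formValue 𝕂 p a z.1‖) := by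
  refine ⟨∑ j, ‖a j‖, ?_⟩
  rintro _ ⟨z, rfl⟩
  refine (norm_sum_le _ _).trans (Finset.sum_le_sum fun j _ => ?_)
  rw [norm_mul, norm_prod]
  refine mul_le_of_le_one_right (norm_nonneg _) (Finset.prod_le_one (fun _ _ => norm_nonneg _) ?_)
  intro i _
  have : Fact (1 ≤ p i) := ⟨hp i⟩
  exact (norm_rclike_map_le _).trans ((PiLp.norm_apply_le (z.1 i) (j i)).trans (z.2 i))

/-- The law of a Rademacher variable: `±1` with probability `1 / 2` each. -/
noncomputable def rademacherLaw : Measure ℂ :=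
  (2⁻¹ : ℝ≥0∞) • Measure.dirac 1 + (2⁻¹ : ℝ≥0∞) • Measure.dirac (-1)

/-- The law of a Steinhaus variable: the normalized Haar measure of the unit circle, the image of
the normalized Haar measure of `ℝ / ℤ` under `t ↦ exp (2 π i t)`. -/
noncomputable def steinhausLaw : Measure ℂ :=
  (AddCircle.haarAddCircle (T := (1 : ℝ))).map fun t => (AddCircle.toCircle t : ℂ)

/-- The law of a real normal Gaussian variable `N(0, 1)`, as a measure on `ℂ`. -/
noncomputable def realGaussianLaw : Measure ℂ := (gaussianReal 0 1).map fun x : ℝ => (x : ℂ)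

/-- The law of a complex normal Gaussian variable `(g + i g') / √2`, with `g`, `g'` independent real
normal Gaussian variables. -/
noncomputable def complexGaussianLaw : Measure ℂ :=
  ((gaussianReal 0 1).prod (gaussianReal 0 1)).map fun x : ℝ × ℝ =>
    ((x.1 : ℂ) + (x.2 : ℂ) * Complex.I) / (Real.sqrt 2 : ℂ)

/-! Upper estimate, `r = 2`: a net of the product of complex unit balls reduces the supremum to at
most `(1 + 4 m) ^ (2 ∑ n_i)` points (`exists_finset_formNorm_le`). At each point the form is a
subgaussian sum whose variance is controlled by the radius `n_i ^ dimExp (p_i)` of an `ℓ_2` ball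
containing the `ℓ_{p_i}` ball, so it has an exponential square moment
(`lintegral_exp_norm_sq_sum_le`). Summing over the net and taking a root of order `L ~ (1 + log m) ∑
n_i` brings the total back below `2` (`lintegral_exp_sq_formNorm_le`).

Upper estimate, `r > 2`: now every `p_i` is at most the conjugate exponent of `r`. The three lines
theorem bounds the norm by `(max |a_j|) ^ (1 - 2/r)` times the `ℓ_2` norm to the power `2/r`
(`formNorm_le_interp`). The coefficients are bounded, so the `r`-th power in the exponential becomes
the square of the `ℓ_2` norm, and the case `r = 2` applies.

Lower estimate: it already holds for the first moment, and it comes from a deterministic bound of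
the norm by the mean modulus of the coefficients (`mul_sum_norm_le_formNorm`). In all variables but
one, basis vectors are replaced by a coordinate vector or a normalized sign vector, which gains `n ^
dimExp p_i` on average by Khinchine's inequality. In the last variable `k` the signs are aligned,
which gains `n ^ (1 - 1/p_k)`; choosing `k` to attain the minimum in `rExp` gives the right
exponent. -/

/-! ### Nets in unit balls. -/

open Metric Module in
/-- A set of `δ`-separated points in the unit ball of a finite-dimensional normed space has at most
`(1 + 2 / δ) ^ dim` elements. -/
theorem card_le_of_separated_unitBall {E : Type*} [NormedAddCommGroup E] [NormedSpace ℝ E]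
    [FiniteDimensional ℝ E] {δ : ℝ} (hδ : 0 < δ) (s : Finset E) (hs : ∀ c ∈ s, ‖c‖ ≤ 1)
    (h : ∀ c ∈ s, ∀ d ∈ s, c ≠ d → δ ≤ ‖c - d‖) :
    (s.card : ℝ) ≤ (1 + 2 / δ) ^ finrank ℝ E := by
  borelize E
  let μ : Measure E := Measure.addHaar
  have hδ2 : 0 < δ / 2 := by positivity
  have hρ : 0 < 1 + δ / 2 := by positivity
  -- Volume comparison: the balls of radius `δ / 2` about the points are disjoint and lie in the
  -- ball of radius `1 + δ / 2`.
  have hdisj : Set.Pairwise (s : Set E)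
      (Function.onFun Disjoint fun c => ball (c : E) (δ / 2)) := by
    rintro c hc d hd hcd
    apply ball_disjoint_ball
    rw [dist_eq_norm, add_halves]
    exact h c hc d hd hcd
  have hsub : (⋃ c ∈ s, ball (c : E) (δ / 2)) ⊆ ball (0 : E) (1 + δ / 2) := by
    refine Set.iUnion₂_subset fun x hx => ball_subset_ball' ?_
    rw [dist_zero_right, add_comm]
    exact add_le_add_left (hs x hx) _
  have hI : (s.card : ℝ≥0∞) * ENNReal.ofReal ((δ / 2) ^ finrank ℝ E) * μ (ball 0 1) ≤
      ENNReal.ofReal ((1 + δ / 2) ^ finrank ℝ E) * μ (ball 0 1) :=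
    calc
      (s.card : ℝ≥0∞) * ENNReal.ofReal ((δ / 2) ^ finrank ℝ E) * μ (ball 0 1)
          = μ (⋃ c ∈ s, ball (c : E) (δ / 2)) := by
        rw [measure_biUnion_finset hdisj fun c _ => measurableSet_ball]
        simp only [μ.addHaar_ball_of_pos _ hδ2, Finset.sum_const, nsmul_eq_mul, mul_assoc]
      _ ≤ μ (ball (0 : E) (1 + δ / 2)) := measure_mono hsub
      _ = ENNReal.ofReal ((1 + δ / 2) ^ finrank ℝ E) * μ (ball 0 1) := by
        simp only [μ.addHaar_ball_of_pos _ hρ]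
  have hJ := (ENNReal.mul_le_mul_iff_left (measure_ball_pos _ _ zero_lt_one).ne'
    measure_ball_lt_top.ne).1 hI
  have hK := ENNReal.toReal_le_of_le_ofReal (pow_nonneg hρ.le _) hJ
  rw [ENNReal.toReal_mul, ENNReal.toReal_natCast, ENNReal.toReal_ofReal (by positivity),
    ← le_div_iff₀ (by positivity), ← div_pow] at hK
  have hq : 1 + 2 / δ = (1 + δ / 2) / (δ / 2) := by
    field_simp
    ring
  rwa [hq]

open Module in
/-- The unit ball of a finite-dimensional normed space has a `δ`-net with at most
`(1 + 2 / δ) ^ dim` elements. -/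
theorem exists_net_unitBall (E : Type*) [NormedAddCommGroup E] [NormedSpace ℝ E]
    [FiniteDimensional ℝ E] {δ : ℝ} (hδ : 0 < δ) :
    ∃ s : Finset E, (∀ c ∈ s, ‖c‖ ≤ 1) ∧ (∀ x : E, ‖x‖ ≤ 1 → ∃ c ∈ s, ‖x - c‖ ≤ δ) ∧
      (s.card : ℝ) ≤ (1 + 2 / δ) ^ finrank ℝ E := by
  classical
  -- A separated set of greatest cardinality is a net, since any uncovered point could be added to
  -- it.
  let P : ℕ → Prop := fun k => ∃ s : Finset E, s.card = k ∧ (∀ c ∈ s, ‖c‖ ≤ 1) ∧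
    ∀ c ∈ s, ∀ d ∈ s, c ≠ d → δ ≤ ‖c - d‖
  have hP0 : P 0 := ⟨∅, by simp⟩
  have hPle : ∀ k, P k → k ≤ ⌊(1 + 2 / δ) ^ finrank ℝ E⌋₊ := by
    rintro k ⟨s, rfl, h1, h2⟩
    exact Nat.le_floor (card_le_of_separated_unitBall hδ s h1 h2)
  obtain ⟨s, hcard, h1, h2⟩ : P (Nat.findGreatest P ⌊(1 + 2 / δ) ^ finrank ℝ E⌋₊) :=
    Nat.findGreatest_spec (Nat.zero_le _) hP0
  refine ⟨s, h1, fun x hx => ?_, card_le_of_separated_unitBall hδ s h1 h2⟩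
  by_contra! hcon
  have hxs : x ∉ s := fun hmem => by
    have := hcon x hmem
    rw [sub_self, norm_zero] at this
    linarith
  have hP : P (s.card + 1) := by
    refine ⟨insert x s, Finset.card_insert_of_notMem hxs, ?_, ?_⟩
    · intro c hc
      rcases Finset.mem_insert.1 hc with rfl | hc
      exacts [hx, h1 c hc]
    · intro c hc d hd hcd
      rcases Finset.mem_insert.1 hc with rfl | hc <;> rcases Finset.mem_insert.1 hd with rfl | hd
      · exact absurd rfl hcd
      · exact (hcon d hd).le
      · rw [norm_sub_rev]
        exact (hcon c (by assumption)).le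
      · exact h2 c hc d hd hcd
  have := Nat.le_findGreatest (hPle _ hP) hP
  omega

/-! ### Exponential square moments of subgaussian sums. -/

theorem lintegral_exp_mul_gaussianReal (t : ℝ) :
    ∫⁻ x, ENNReal.ofReal (Real.exp (t * x)) ∂(gaussianReal 0 1) =
      ENNReal.ofReal (Real.exp (t ^ 2 / 2)) := by
  rw [← ofReal_integral_eq_lintegral_ofReal (integrable_exp_mul_gaussianReal t)
    (Filter.Eventually.of_forall fun x => (Real.exp_pos _).le)]
  have := congrFun (mgf_fun_id_gaussianReal (μ := 0) (v := 1)) t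
  rw [mgf] at this
  rw [this]
  simp

/-- `𝔼 exp (g² / 4) = √2` for a standard Gaussian variable. -/
theorem lintegral_exp_sq_gaussianReal :
    ∫⁻ x, ENNReal.ofReal (Real.exp (x ^ 2 / 4)) ∂(gaussianReal 0 1) = ENNReal.ofReal (√2) := by
  rw [gaussianReal_of_var_ne_zero _ one_ne_zero,
    lintegral_withDensity_eq_lintegral_mul _ (measurable_gaussianPDF _ _) (by fun_prop)]
  have h1 : ∀ x : ℝ, (gaussianPDF 0 1 * fun x => ENNReal.ofReal (Real.exp (x ^ 2 / 4))) x =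
      ENNReal.ofReal ((√(2 * Real.pi))⁻¹ * Real.exp (-(1 / 4) * x ^ 2)) := by
    intro x
    rw [Pi.mul_apply, gaussianPDF, ← ENNReal.ofReal_mul (gaussianPDFReal_nonneg _ _ _),
      gaussianPDFReal, mul_assoc, ← Real.exp_add]
    congr 3
    · simp
    · simp
      ring
  simp_rw [h1]
  rw [← ofReal_integral_eq_lintegral_ofReal
    ((integrable_exp_neg_mul_sq (by norm_num : (0 : ℝ) < 1 / 4)).const_mul _)
    (Filter.Eventually.of_forall fun x => by positivity), integral_const_mul, integral_gaussian]
  congr 1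
  rw [← Real.sqrt_inv, ← Real.sqrt_mul (by positivity)]
  congr 1
  field_simp
  norm_num

/-- The square of a subgaussian variable has an exponential moment. -/
theorem lintegral_exp_sq_le_of_hasSubgaussianMGF {Ω : Type*} [MeasurableSpace Ω] {μ : Measure Ω}
    [IsProbabilityMeasure μ] {Y : Ω → ℝ} {c : NNReal} (hY : HasSubgaussianMGF Y c μ) {v : ℝ}
    (hv : 0 < v) (hcv : c ≤ v) :
    ∫⁻ ω, ENNReal.ofReal (Real.exp (Y ω ^ 2 / (4 * v))) ∂μ ≤ 2 := by
  -- The square is linearized by an auxiliary Gaussian variable `g`: `exp (Y² / (4 v)) = 𝔼_g exp (t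
  -- Y g)`. After Tonelli only the moment generating function of `Y` is needed.
  set t : ℝ := (√(2 * v))⁻¹ with ht
  have ht2 : t ^ 2 = (2 * v)⁻¹ := by rw [ht, inv_pow, Real.sq_sqrt (by positivity)]
  have hYm := hY.aemeasurable
  calc ∫⁻ ω, ENNReal.ofReal (Real.exp (Y ω ^ 2 / (4 * v))) ∂μ
      = ∫⁻ ω, ∫⁻ x, ENNReal.ofReal (Real.exp (t * Y ω * x)) ∂(gaussianReal 0 1) ∂μ := by
        refine lintegral_congr fun ω => ?_
        rw [lintegral_exp_mul_gaussianReal, mul_pow, ht2]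
        congr 2
        field_simp
        norm_num
    _ = ∫⁻ x, ∫⁻ ω, ENNReal.ofReal (Real.exp (t * Y ω * x)) ∂μ ∂(gaussianReal 0 1) := by
        refine lintegral_lintegral_swap ?_
        have h1 : AEMeasurable (fun z : Ω × ℝ => Y z.1) (μ.prod (gaussianReal 0 1)) :=
          hYm.comp_quasiMeasurePreserving Measure.quasiMeasurePreserving_fst
        exact ENNReal.measurable_ofReal.comp_aemeasurable
          (Real.measurable_exp.comp_aemeasurable ((h1.const_mul t).mul measurable_snd.aemeasurable))
    _ ≤ ∫⁻ x, ENNReal.ofReal (Real.exp (x ^ 2 / 4)) ∂(gaussianReal 0 1) := by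
        refine lintegral_mono fun x => ?_
        have h1 : ∀ ω, t * Y ω * x = (t * x) * Y ω := fun ω => by ring
        simp_rw [h1]
        rw [← ofReal_integral_eq_lintegral_ofReal (hY.integrable_exp_mul _)
          (Filter.Eventually.of_forall fun x => (Real.exp_pos _).le)]
        refine ENNReal.ofReal_le_ofReal ((hY.mgf_le _).trans (Real.exp_le_exp.2 ?_))
        rw [mul_pow, ht2]
        have h2 : (c : ℝ) * ((2 * v)⁻¹ * x ^ 2) ≤ v * ((2 * v)⁻¹ * x ^ 2) := by gcongr
        have h3 : v * ((2 * v)⁻¹ * x ^ 2) / 2 = x ^ 2 / 4 := by field_simp; ring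
        linarith
    _ = ENNReal.ofReal (√2) := lintegral_exp_sq_gaussianReal
    _ ≤ 2 := by
        rw [← ENNReal.ofReal_ofNat]
        exact ENNReal.ofReal_le_ofReal (by rw [Real.sqrt_le_left (by norm_num)]; norm_num)

/-- A linear combination of independent subgaussian complex variables has an exponential square
moment. -/
theorem lintegral_exp_norm_sq_sum_le {Ω ι : Type*} [MeasurableSpace Ω] [Fintype ι] {μ : Measure Ω}
    [IsProbabilityMeasure μ] {γ : ι → Ω → ℂ} {s v : ℝ} {b : ι → ℂ}
    (hind : iIndepFun γ μ) (hsub : ∀ j, IsSubgaussianWith (γ j) s μ)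
    (hv : 0 < v) (hb : s ^ 2 * ∑ j, ‖b j‖ ^ 2 ≤ v) :
    ∫⁻ ω, ENNReal.ofReal (Real.exp (‖∑ j, γ j ω * b j‖ ^ 2 / (8 * v))) ∂μ ≤ 2 := by
  -- The choices `w = 1` and `w = -I` give the real and the imaginary part of the sum.
  have key : ∀ w : ℂ, ‖w‖ = 1 →
      ∃ c : NNReal, (c : ℝ) ≤ v ∧ HasSubgaussianMGF (fun ω => (w * ∑ j, γ j ω * b j).re) c μ := by
    intro w hw
    let c : ι → NNReal := fun j => ⟨s ^ 2 * ‖b j‖ ^ 2, by positivity⟩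
    refine ⟨∑ j, c j, ?_, ?_⟩
    · rw [NNReal.coe_sum]
      change ∑ j, s ^ 2 * ‖b j‖ ^ 2 ≤ v
      rwa [← Finset.mul_sum]
    · have h1 : HasSubgaussianMGF (fun ω => ∑ j, (w * b j * γ j ω).re) (∑ j, c j) μ := by
        refine HasSubgaussianMGF.sum_of_iIndepFun (X := fun j ω => (w * b j * γ j ω).re)
          (hind.comp (fun j z => (w * b j * z).re) fun j => by fun_prop) fun j _ => ?_
        have h2 : ∀ t : ℝ, ∀ ω, t * (w * b j * γ j ω).re = ((t * w * b j : ℂ) * γ j ω).re := by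
          intro t ω
          rw [mul_assoc (t : ℂ), mul_assoc (t : ℂ), Complex.re_ofReal_mul]
        refine ⟨fun t => ?_, fun t => ?_⟩
        · simp_rw [h2]
          exact (hsub j _).1
        · rw [mgf]
          simp_rw [h2]
          refine ((hsub j _).2).trans (Real.exp_le_exp.2 (le_of_eq ?_))
          change _ = s ^ 2 * ‖b j‖ ^ 2 * t ^ 2 / 2
          rw [norm_mul, norm_mul, hw, Complex.norm_real, mul_one, mul_pow, Real.norm_eq_abs, sq_abs]
          ring
      convert h1 using 2 with ω
      rw [Finset.mul_sum, Complex.re_sum]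
      exact Finset.sum_congr rfl fun j _ => by rw [mul_comm (γ j ω), mul_assoc]
  obtain ⟨c₁, hc₁, h₁⟩ := key 1 (by simp)
  obtain ⟨c₂, hc₂, h₂⟩ := key (-Complex.I) (by simp)
  have e₁ := lintegral_exp_sq_le_of_hasSubgaussianMGF h₁ hv hc₁
  have e₂ := lintegral_exp_sq_le_of_hasSubgaussianMGF h₂ hv hc₂
  have m₁ : AEMeasurable (fun ω => ENNReal.ofReal
      (Real.exp ((1 * ∑ j, γ j ω * b j).re ^ 2 / (4 * v)))) μ := by
    have := h₁.aemeasurable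
    fun_prop
  -- Convexity, `exp ((x + y) / 2) ≤ (exp x + exp y) / 2`; this is why `4 v` becomes `8 v`.
  have hpt : ∀ ω, ENNReal.ofReal (Real.exp (‖∑ j, γ j ω * b j‖ ^ 2 / (8 * v))) ≤
      2⁻¹ * (ENNReal.ofReal (Real.exp ((1 * ∑ j, γ j ω * b j).re ^ 2 / (4 * v))) +
        ENNReal.ofReal (Real.exp ((-Complex.I * ∑ j, γ j ω * b j).re ^ 2 / (4 * v)))) := by
    intro ω
    set X := ∑ j, γ j ω * b j
    have hX : ‖X‖ ^ 2 / (8 * v) = X.re ^ 2 / (4 * v) / 2 + X.im ^ 2 / (4 * v) / 2 := by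
      rw [Complex.sq_norm, Complex.normSq_apply]
      field_simp
      ring
    have h2 : (2⁻¹ : ℝ≥0∞) = ENNReal.ofReal 2⁻¹ := by
      rw [ENNReal.ofReal_inv_of_pos (by norm_num), ENNReal.ofReal_ofNat]
    rw [h2, ← ENNReal.ofReal_add (Real.exp_pos _).le (Real.exp_pos _).le,
      ← ENNReal.ofReal_mul (by norm_num)]
    refine ENNReal.ofReal_le_ofReal ?_
    have h3 : (1 * X).re = X.re := by simp
    have h4 : (-Complex.I * X).re = X.im := by simp
    rw [hX, h3, h4, Real.exp_add, Real.exp_half, Real.exp_half]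
    have h5 := Real.sq_sqrt (Real.exp_pos (X.re ^ 2 / (4 * v))).le
    have h6 := Real.sq_sqrt (Real.exp_pos (X.im ^ 2 / (4 * v))).le
    nlinarith [sq_nonneg (√(Real.exp (X.re ^ 2 / (4 * v))) - √(Real.exp (X.im ^ 2 / (4 * v))))]
  refine (lintegral_mono hpt).trans ?_
  rw [lintegral_const_mul' _ _ (by simp), lintegral_add_left' m₁]
  calc (2⁻¹ : ℝ≥0∞) * _ ≤ 2⁻¹ * (2 + 2) := by gcongr
    _ = 2 := by rw [← two_mul, ← mul_assoc, ENNReal.inv_mul_cancel (by simp) (by simp), one_mul]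

/-! ### Unit balls of `ℓ_p^n`. -/

theorem PiLp.norm_le_one_iff_sum_rpow {ι 𝕂 : Type*} [Fintype ι] [RCLike 𝕂] {p : ℝ≥0∞}
    (hp : 1 ≤ p) (hp' : p ≠ ∞) (z : PiLp p (fun _ : ι => 𝕂)) :
    ‖z‖ ≤ 1 ↔ ∑ t, ‖z t‖ ^ p.toReal ≤ 1 := by
  have h0 : 0 < p.toReal := ENNReal.toReal_pos (zero_lt_one.trans_le hp).ne' hp'
  have hS : 0 ≤ ∑ t, ‖z t‖ ^ p.toReal := Finset.sum_nonneg fun t _ => by positivity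
  rw [PiLp.norm_eq_sum h0]
  rw [one_div, Real.rpow_inv_le_iff_of_pos hS zero_le_one h0, Real.one_rpow]

theorem PiLp.norm_le_one_iff_forall {ι 𝕂 : Type*} [Fintype ι] [RCLike 𝕂]
    (z : PiLp ∞ (fun _ : ι => 𝕂)) : ‖z‖ ≤ 1 ↔ ∀ t, ‖z t‖ ≤ 1 := by
  rw [PiLp.norm_eq_ciSup]
  exact ⟨fun h t => (le_ciSup (Set.finite_range _).bddAbove t).trans h,
    fun h => Real.iSup_le h zero_le_one⟩

theorem PiLp.coord_le_one {ι 𝕂 : Type*} [Fintype ι] [RCLike 𝕂] {p : ℝ≥0∞} (hp : 1 ≤ p)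
    {z : PiLp p (fun _ : ι => 𝕂)} (hz : ‖z‖ ≤ 1) (t : ι) : ‖z t‖ ≤ 1 := by
  have : Fact (1 ≤ p) := ⟨hp⟩
  exact (PiLp.norm_apply_le z t).trans hz

theorem PiLp.norm_le_one_of_norm_le {ι 𝕂 𝕃 : Type*} [Fintype ι] [RCLike 𝕂] [RCLike 𝕃] {p : ℝ≥0∞}
    (hp : 1 ≤ p) {z : PiLp p (fun _ : ι => 𝕂)} {w : PiLp p (fun _ : ι => 𝕃)}
    (h : ∀ t, ‖w t‖ ≤ ‖z t‖) (hz : ‖z‖ ≤ 1) : ‖w‖ ≤ 1 := by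
  rcases eq_or_ne p ∞ with rfl | hp'
  · rw [PiLp.norm_le_one_iff_forall] at hz ⊢
    exact fun t => (h t).trans (hz t)
  · rw [PiLp.norm_le_one_iff_sum_rpow hp hp'] at hz ⊢
    refine le_trans (Finset.sum_le_sum fun t _ => ?_) hz
    exact Real.rpow_le_rpow (norm_nonneg _) (h t) ENNReal.toReal_nonneg

theorem dimExp_nonneg (p : ℝ≥0∞) : 0 ≤ dimExp p := le_max_right _ _

/-- The unit ball of `ℓ_p^n` is contained in the ball of radius `n ^ dimExp p` of `ℓ_2^n`. -/
theorem PiLp.sum_sq_le_rpow_dimExp {𝕂 : Type*} [RCLike 𝕂] {n : ℕ} (hn : 0 < n) {p : ℝ≥0∞}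
    (hp : 1 ≤ p) {z : PiLp p (fun _ : Fin n => 𝕂)} (hz : ‖z‖ ≤ 1) :
    ∑ t, ‖z t‖ ^ 2 ≤ ((n : ℝ) ^ dimExp p) ^ 2 := by
  have hn1 : (1 : ℝ) ≤ n := by exact_mod_cast hn
  have hc := PiLp.coord_le_one hp hz
  rcases eq_or_ne p ∞ with rfl | hp'
  · have h1 : ((n : ℝ) ^ dimExp ∞) ^ 2 = n := by
      rw [← Real.rpow_natCast, ← Real.rpow_mul (by positivity)]
      norm_num [dimExp]
    rw [h1]
    calc ∑ t, ‖z t‖ ^ 2 ≤ ∑ _t : Fin n, (1 : ℝ) :=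
          Finset.sum_le_sum fun t _ => pow_le_one₀ (norm_nonneg _) (hc t)
      _ = n := by simp
  · have hz' := (PiLp.norm_le_one_iff_sum_rpow hp hp' z).1 hz
    have hpr : 1 ≤ p.toReal := by
      simpa using ENNReal.toReal_mono hp' hp
    rcases le_total p.toReal 2 with h2 | h2
    · calc ∑ t, ‖z t‖ ^ 2 ≤ ∑ t, ‖z t‖ ^ p.toReal := by
            refine Finset.sum_le_sum fun t _ => ?_
            rw [← Real.rpow_natCast]
            exact Real.rpow_le_rpow_of_exponent_ge' (norm_nonneg _) (hc t) (by linarith)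
              (by exact_mod_cast h2)
        _ ≤ 1 := hz'
        _ ≤ ((n : ℝ) ^ dimExp p) ^ 2 :=
            one_le_pow₀ (Real.one_le_rpow hn1 (dimExp_nonneg p))
    -- For `p ≥ 2`, the power mean inequality with exponent `p / 2` for the squares.
    · have h3 := Real.rpow_sum_le_const_mul_sum_rpow_of_nonneg (s := Finset.univ)
        (f := fun t => ‖z t‖ ^ 2) (p := p.toReal / 2) (by linarith) fun t _ => by positivity
      have h4 : ∀ t, (‖z t‖ ^ 2) ^ (p.toReal / 2) = ‖z t‖ ^ p.toReal := by
        intro t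
        rw [← Real.rpow_natCast, ← Real.rpow_mul (norm_nonneg _)]
        congr 1
        push_cast
        ring
      simp_rw [h4] at h3
      have h5 : (∑ t, ‖z t‖ ^ 2) ^ (p.toReal / 2) ≤ (n : ℝ) ^ (p.toReal / 2 - 1) := by
        refine h3.trans ?_
        rw [Finset.card_univ, Fintype.card_fin]
        exact mul_le_of_le_one_right (by positivity) hz'
      have hd : dimExp p = 1 / 2 - p.toReal⁻¹ := by
        rw [dimExp, ENNReal.toReal_inv, max_eq_left]
        have : p.toReal⁻¹ ≤ 2⁻¹ := inv_anti₀ (by norm_num) h2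
        linarith
      have h6 : ((n : ℝ) ^ dimExp p) ^ 2 = ((n : ℝ) ^ (p.toReal / 2 - 1)) ^ (p.toReal / 2)⁻¹ := by
        rw [← Real.rpow_natCast, ← Real.rpow_mul (by positivity), ← Real.rpow_mul (by positivity),
          hd]
        congr 1
        field_simp
        push_cast
        ring
      rw [h6]
      exact (Real.le_rpow_inv_iff_of_pos (Finset.sum_nonneg fun t _ => by positivity)
        (by positivity) (by linarith)).2 h5

/-! ### Norms of multilinear forms: discretization, variance, interpolation. -/

section Form

variable {𝕂 : Type*} [RCLike 𝕂] {m : ℕ} {n : Fin m → ℕ} {p : Fin m → ℝ≥0∞}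

theorem norm_formValue_le_formNorm (hp : ∀ i, 1 ≤ p i) (a : (∀ i, Fin (n i)) → ℂ)
    {z : ∀ i, PiLp (p i) (fun _ : Fin (n i) => 𝕂)} (hz : ∀ i, ‖z i‖ ≤ 1) :
    ‖formValue 𝕂 p a z‖ ≤ formNorm 𝕂 p a :=
  le_ciSup (bddAbove_formValue 𝕂 p hp a) ⟨z, hz⟩

theorem formNorm_nonneg (a : (∀ i, Fin (n i)) → ℂ) : 0 ≤ formNorm 𝕂 p a :=
  Real.iSup_nonneg fun _ => norm_nonneg _

theorem formNorm_le {a : (∀ i, Fin (n i)) → ℂ} {K : ℝ} (hK : 0 ≤ K)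
    (h : ∀ z : ∀ i, PiLp (p i) (fun _ : Fin (n i) => 𝕂), (∀ i, ‖z i‖ ≤ 1) →
      ‖formValue 𝕂 p a z‖ ≤ K) : formNorm 𝕂 p a ≤ K :=
  Real.iSup_le (fun z => h z.1 z.2) hK

/-- The `𝕂`-ball embeds in the complex ball, so upper estimates are needed only over `ℂ`. -/
theorem formNorm_le_formNorm_complex (hp : ∀ i, 1 ≤ p i) (a : (∀ i, Fin (n i)) → ℂ) :
    formNorm 𝕂 p a ≤ formNorm ℂ p a := by
  refine formNorm_le (formNorm_nonneg a) fun z hz => ?_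
  let w : ∀ i, PiLp (p i) (fun _ : Fin (n i) => ℂ) :=
    fun i => WithLp.toLp (p i) fun t => RCLike.map 𝕂 ℂ (z i t)
  have hw : ∀ i, ‖w i‖ ≤ 1 := fun i =>
    PiLp.norm_le_one_of_norm_le (hp i) (fun t => norm_rclike_map_le (z i t)) (hz i)
  have hzw : formValue 𝕂 p a z = formValue ℂ p a w := by
    simp [formValue, w]
  rw [hzw]
  exact norm_formValue_le_formNorm hp a hw

/-- The `m`-linear form with coefficients `a`. -/
noncomputable def formMap [∀ i, Fact (1 ≤ p i)] (a : (∀ i, Fin (n i)) → ℂ) :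
    ContinuousMultilinearMap ℂ (fun i => PiLp (p i) (fun _ : Fin (n i) => ℂ)) ℂ :=
  ∑ j : (∀ i, Fin (n i)), a j • (ContinuousMultilinearMap.mkPiAlgebra ℂ (Fin m) ℂ
    ).compContinuousLinearMap fun i => PiLp.proj (p i) (fun _ : Fin (n i) => ℂ) (j i)

theorem formMap_apply [∀ i, Fact (1 ≤ p i)] (a : (∀ i, Fin (n i)) → ℂ)
    (z : ∀ i, PiLp (p i) (fun _ : Fin (n i) => ℂ)) : formMap a z = formValue ℂ p a z := by
  simp [formMap, formValue]

theorem norm_formMap_le [∀ i, Fact (1 ≤ p i)] {a : (∀ i, Fin (n i)) → ℂ} {K : ℝ} (hK : 0 ≤ K)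
    (h : ∀ z : ∀ i, PiLp (p i) (fun _ : Fin (n i) => ℂ), ‖z‖ ≤ 1 → ‖formMap a z‖ ≤ K) :
    ‖formMap (p := p) a‖ ≤ K := by
  refine ContinuousMultilinearMap.opNorm_le_bound hK fun z => ?_
  by_cases hz : ∃ i, z i = 0
  · obtain ⟨i, hi⟩ := hz
    rw [(formMap a).map_coord_zero i hi, norm_zero]
    exact mul_nonneg hK (Finset.prod_nonneg fun _ _ => norm_nonneg _)
  · push Not at hz
    let u : ∀ i, PiLp (p i) (fun _ : Fin (n i) => ℂ) := fun i => ((‖z i‖⁻¹ : ℝ) : ℂ) • z i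
    have hu : ‖u‖ ≤ 1 := (pi_norm_le_iff_of_nonneg zero_le_one).2 fun i => by
      rw [norm_smul, Complex.norm_real, norm_inv, norm_norm, inv_mul_cancel₀]
      exact norm_ne_zero_iff.2 (hz i)
    have hzu : z = fun i => ((‖z i‖ : ℝ) : ℂ) • u i := by
      funext i
      rw [smul_smul, ← Complex.ofReal_mul, mul_inv_cancel₀ (norm_ne_zero_iff.2 (hz i)),
        Complex.ofReal_one, one_smul]
    calc ‖formMap a z‖ = ‖formMap a fun i => ((‖z i‖ : ℝ) : ℂ) • u i‖ := by rw [← hzu]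
      _ = (∏ i, ‖z i‖) * ‖formMap a u‖ := by
        rw [(formMap a).map_smul_univ, norm_smul, norm_prod]
        simp
      _ ≤ (∏ i, ‖z i‖) * K := by
        have := h u hu
        gcongr
      _ = K * ∏ i, ‖z i‖ := mul_comm _ _

open Module in
theorem finrank_pi_piLp (p : Fin m → ℝ≥0∞) [∀ i, Fact (1 ≤ p i)] (n : Fin m → ℕ) :
    finrank ℝ (∀ i, PiLp (p i) (fun _ : Fin (n i) => ℂ)) = 2 * ∑ i, n i := by
  rw [finrank_pi_fintype, Finset.mul_sum]
  refine Finset.sum_congr rfl fun i _ => ?_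
  rw [(WithLp.linearEquiv (p i) ℝ (Fin (n i) → ℂ)).finrank_eq, finrank_pi_fintype]
  simp [Complex.finrank_real_complex, mul_comm]

/-- The norm of an `m`-linear form is controlled by its values on a finite set that does not depend
on the form. -/
theorem exists_finset_formNorm_le (hm : 0 < m) (hp : ∀ i, 1 ≤ p i) :
    ∃ F : Finset (∀ i, PiLp (p i) (fun _ : Fin (n i) => ℂ)),
      (∀ z ∈ F, ∀ i, ‖z i‖ ≤ 1) ∧ (F.card : ℝ) ≤ (1 + 4 * m) ^ (2 * ∑ i, n i) ∧
      ∀ a, ∃ z ∈ F, formNorm ℂ p a ≤ 2 * ‖formValue ℂ p a z‖ := by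
  have : ∀ i, Fact (1 ≤ p i) := fun i => ⟨hp i⟩
  have hm' : (0 : ℝ) < m := by exact_mod_cast hm
  -- Moving a point of the ball by `δ` changes the form by at most `m δ` times its norm. With `δ = 1
  -- / (2 m)` the error is half the norm and can be absorbed; then `1 + 2 / δ = 1 + 4 m`.
  obtain ⟨F, hF1, hFnet, hFcard⟩ := exists_net_unitBall
    (∀ i, PiLp (p i) (fun _ : Fin (n i) => ℂ)) (δ := 1 / (2 * m)) (by positivity)
  have hball : ∀ z : ∀ i, PiLp (p i) (fun _ : Fin (n i) => ℂ), ‖z‖ ≤ 1 ↔ ∀ i, ‖z i‖ ≤ 1 :=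
    fun z => pi_norm_le_iff_of_nonneg zero_le_one
  have hFne : F.Nonempty := by
    obtain ⟨c, hc, -⟩ := hFnet 0 (by simp)
    exact ⟨c, hc⟩
  refine ⟨F, fun z hz => (hball z).1 (hF1 z hz), ?_, fun a => ?_⟩
  · rw [finrank_pi_piLp] at hFcard
    refine hFcard.trans (le_of_eq ?_)
    congr 1
    field_simp
    ring
  · obtain ⟨z₀, hz₀, hmax⟩ := F.exists_max_image (fun z => ‖formMap (p := p) a z‖) hFne
    refine ⟨z₀, hz₀, ?_⟩
    have hop : ‖formMap (p := p) a‖ ≤ ‖formMap a z₀‖ + ‖formMap (p := p) a‖ / 2 := by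
      refine norm_formMap_le (by positivity) fun z hz => ?_
      obtain ⟨c, hc, hzc⟩ := hFnet z hz
      have h1 := (formMap (p := p) a).norm_image_sub_le z c
      have h2 : max ‖z‖ ‖c‖ ^ (Fintype.card (Fin m) - 1) ≤ 1 :=
        pow_le_one₀ (by positivity) (max_le hz (hF1 c hc))
      have h3 : ‖formMap (p := p) a z - formMap a c‖ ≤ ‖formMap (p := p) a‖ / 2 := by
        refine h1.trans ?_
        calc _ ≤ ‖formMap (p := p) a‖ * Fintype.card (Fin m) * 1 * (1 / (2 * m)) := by gcongr
          _ = ‖formMap (p := p) a‖ / 2 := by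
            rw [Fintype.card_fin]
            field_simp
      calc ‖formMap (p := p) a z‖ = ‖formMap (p := p) a c + (formMap a z - formMap a c)‖ := by
            congr 1
            ring
        _ ≤ ‖formMap (p := p) a c‖ + ‖formMap (p := p) a z - formMap a c‖ := norm_add_le _ _
        _ ≤ _ := add_le_add (hmax c hc) h3
    rw [← formMap_apply]
    refine formNorm_le (by positivity) fun z hz => ?_
    rw [← formMap_apply]
    have h4 := (formMap (p := p) a).unit_le_opNorm ((hball z).2 hz)
    linarith

theorem sum_prod_eq_prod_sum {R : Type*} [CommSemiring R] (f : ∀ i, Fin (n i) → R) :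
    ∑ j : (∀ i, Fin (n i)), ∏ i, f i (j i) = ∏ i, ∑ t, f i t := by
  rw [Finset.prod_univ_sum, Fintype.piFinset_univ]

/-- The variance of a random `m`-linear form at a point of the unit ball. -/
theorem sum_sq_coeff_le (hn : ∀ i, 0 < n i) (hp : ∀ i, 1 ≤ p i) {c : (∀ i, Fin (n i)) → ℂ} {S : ℝ}
    (hc : ∀ j, ‖c j‖ ≤ S) {z : ∀ i, PiLp (p i) (fun _ : Fin (n i) => ℂ)} (hz : ∀ i, ‖z i‖ ≤ 1) :
    ∑ j : (∀ i, Fin (n i)), ‖c j * ∏ i, RCLike.map ℂ ℂ (z i (j i))‖ ^ 2 ≤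
      (S * ∏ i, (n i : ℝ) ^ dimExp (p i)) ^ 2 := by
  calc ∑ j : (∀ i, Fin (n i)), ‖c j * ∏ i, RCLike.map ℂ ℂ (z i (j i))‖ ^ 2
      ≤ ∑ j : (∀ i, Fin (n i)), S ^ 2 * ∏ i, ‖z i (j i)‖ ^ 2 := by
        refine Finset.sum_le_sum fun j _ => ?_
        rw [norm_mul, norm_prod, mul_pow, ← Finset.prod_pow]
        have := hc j
        simp only [RCLike.map_same_eq_id, ContinuousLinearMap.id_apply]
        gcongr
    _ = S ^ 2 * ∏ i, ∑ t, ‖z i t‖ ^ 2 := by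
        rw [← Finset.mul_sum, sum_prod_eq_prod_sum fun i t => ‖z i t‖ ^ 2]
    _ ≤ S ^ 2 * ∏ i, ((n i : ℝ) ^ dimExp (p i)) ^ 2 := by
        gcongr with i
        exact PiLp.sum_sq_le_rpow_dimExp (hn i) (hp i) (hz i)
    _ = (S * ∏ i, (n i : ℝ) ^ dimExp (p i)) ^ 2 := by
        rw [Finset.prod_pow, mul_pow]

open Complex HadamardThreeLines in
/-- Interpolation of the norm of an `m`-linear form between `ℓ_1 × ⋯ × ℓ_1` and
`ℓ_2 × ⋯ × ℓ_2`. -/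
theorem formNorm_le_interp {r : ℝ} (hr : 2 ≤ r) (hp : ∀ i, 1 ≤ p i) (hp' : ∀ i, p i ≠ ∞)
    (hpr : ∀ i, (p i).toReal * (1 - 1 / r) ≤ 1) {a : (∀ i, Fin (n i)) → ℂ} {K : ℝ} (hK : 0 ≤ K)
    (ha : ∀ j, ‖a j‖ ≤ K) :
    formNorm ℂ p a ≤ K ^ (1 - 2 / r) * formNorm ℂ (fun _ => 2) a ^ (2 / r) := by
  have hr0 : 0 < r := by linarith
  have hir : 1 / r ≤ 1 / 2 := one_div_le_one_div_of_le (by norm_num) hr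
  have h1r : 0 < 1 - 1 / r := by linarith
  refine formNorm_le (by have := formNorm_nonneg (𝕂 := ℂ) (p := fun _ => 2) a; positivity)
    fun z hz => ?_
  -- `q` is conjugate to `r`; since `p i ≤ q`, each `z i` lies in the unit ball of `ℓ_q`.
  set q : ℝ := (1 - 1 / r)⁻¹ with hq
  have hq0 : 0 < q := inv_pos.2 h1r
  have hzc : ∀ i t, ‖z i t‖ ≤ 1 := fun i t => PiLp.coord_le_one (hp i) (hz i) t
  have hzq : ∀ i, ∑ t, ‖z i t‖ ^ q ≤ 1 := fun i => by
    refine le_trans (Finset.sum_le_sum fun t _ => ?_)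
      ((PiLp.norm_le_one_iff_sum_rpow (hp i) (hp' i) _).1 (hz i))
    refine Real.rpow_le_rpow_of_exponent_ge' (norm_nonneg _) (hzc i t) ENNReal.toReal_nonneg ?_
    rw [hq, ← one_div, le_div_iff₀ h1r]
    exact hpr i
  -- Analytic family keeping the phases of `z` and giving the moduli the exponent `q (1 - Re ζ /
  -- 2)`: in the `ℓ_1` ball for `Re ζ = 0`, in the `ℓ_2` ball for `Re ζ = 1`, and equal to `z` at `ζ
  -- = 2 / r`.
  let g : ℂ → ∀ i, Fin (n i) → ℂ := fun ζ i t =>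
    if z i t = 0 then 0 else z i t / (‖z i t‖ : ℂ) * exp (Real.log ‖z i t‖ * (q * (1 - ζ / 2)))
  have hg : ∀ ζ i t, z i t ≠ 0 → ‖g ζ i t‖ = ‖z i t‖ ^ (q * (1 - ζ.re / 2)) := by
    intro ζ i t h0
    have h0' : ‖z i t‖ ≠ 0 := norm_ne_zero_iff.2 h0
    simp only [g, if_neg h0]
    rw [norm_mul, norm_div, Complex.norm_real, norm_norm, div_self h0', one_mul, Complex.norm_exp,
      Real.rpow_def_of_pos (norm_pos_iff.2 h0)]
    congr 1
    rw [Complex.re_ofReal_mul, Complex.re_ofReal_mul]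
    simp
  have hg1 : ∀ ζ : ℂ, ζ.re ≤ 1 → ∀ i t, ‖g ζ i t‖ ≤ 1 := by
    intro ζ hζ i t
    by_cases h0 : z i t = 0
    · simp [g, h0]
    · rw [hg ζ i t h0]
      exact Real.rpow_le_one (norm_nonneg _) (hzc i t)
        (mul_nonneg hq0.le (by linarith))
  let F : ℂ → ℂ := fun ζ => ∑ j : (∀ i, Fin (n i)), a j * ∏ i, g ζ i (j i)
  have hFd : Differentiable ℂ F := by
    refine Differentiable.fun_sum fun j _ => Differentiable.const_mul ?_ _
    refine Differentiable.fun_finsetProd fun i _ => ?_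
    by_cases h0 : z i (j i) = 0
    · simp [g, h0]
    · simp only [g, if_neg h0]
      fun_prop
  have hFθ : F ((2 / r : ℝ) : ℂ) = formValue ℂ p a z := by
    simp only [F, formValue]
    refine Finset.sum_congr rfl fun j _ => ?_
    congr 1
    refine Finset.prod_congr rfl fun i _ => ?_
    by_cases h0 : z i (j i) = 0
    · simp [g, h0]
    · have h0' : (‖z i (j i)‖ : ℂ) ≠ 0 := by exact_mod_cast norm_ne_zero_iff.2 h0
      have h2 : (q : ℂ) * (1 - ((2 / r : ℝ) : ℂ) / 2) = 1 := by
        have h3 : q * (1 - 2 / r / 2) = 1 := by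
          have h4 : 1 - 2 / r / 2 = 1 - 1 / r := by ring
          rw [h4, hq, inv_mul_cancel₀ h1r.ne']
        exact_mod_cast h3
      simp only [g, if_neg h0]
      rw [h2, mul_one, ← Complex.ofReal_exp, Real.exp_log (norm_pos_iff.2 h0),
        div_mul_cancel₀ _ h0']
      simp
  have h0 : ∀ ζ ∈ re ⁻¹' {0}, ‖F ζ‖ ≤ K := by
    intro ζ hζ
    have hζ0 : ζ.re = 0 := hζ
    calc ‖F ζ‖ ≤ ∑ j : (∀ i, Fin (n i)), ‖a j * ∏ i, g ζ i (j i)‖ := norm_sum_le _ _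
      _ ≤ ∑ j : (∀ i, Fin (n i)), K * ∏ i, ‖g ζ i (j i)‖ := by
        refine Finset.sum_le_sum fun j _ => ?_
        rw [norm_mul, norm_prod]
        exact mul_le_mul_of_nonneg_right (ha j) (Finset.prod_nonneg fun _ _ => norm_nonneg _)
      _ = K * ∏ i, ∑ t, ‖g ζ i t‖ := by
        rw [← Finset.mul_sum, sum_prod_eq_prod_sum fun i t => ‖g ζ i t‖]
      _ ≤ K := by
        refine mul_le_of_le_one_right hK (Finset.prod_le_one
          (fun _ _ => Finset.sum_nonneg fun _ _ => norm_nonneg _) fun i _ => ?_)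
        refine le_trans (Finset.sum_le_sum fun t _ => ?_) (hzq i)
        by_cases h0 : z i t = 0
        · simp only [g, if_pos h0, norm_zero]
          positivity
        · rw [hg ζ i t h0, hζ0]
          simp
  have h1 : ∀ ζ ∈ re ⁻¹' {1}, ‖F ζ‖ ≤ formNorm ℂ (fun _ => 2) a := by
    intro ζ hζ
    have hζ1 : ζ.re = 1 := hζ
    let w : ∀ i, PiLp ((fun _ => 2 : Fin m → ℝ≥0∞) i) (fun _ : Fin (n i) => ℂ) :=
      fun i => WithLp.toLp 2 (g ζ i)
    have hFw : F ζ = formValue ℂ (fun _ => 2) a w := by simp [F, formValue, w]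
    rw [hFw]
    refine norm_formValue_le_formNorm (fun _ => by norm_num) a fun i => ?_
    rw [PiLp.norm_le_one_iff_sum_rpow (by norm_num) (by norm_num)]
    refine le_trans (Finset.sum_le_sum fun t _ => ?_) (hzq i)
    change ‖g ζ i t‖ ^ ((2 : ℝ≥0∞).toReal) ≤ _
    by_cases h0 : z i t = 0
    · simp only [g, if_pos h0, norm_zero]
      rw [Real.zero_rpow (by norm_num)]
      positivity
    · rw [hg ζ i t h0, hζ1, ← Real.rpow_mul (norm_nonneg _)]
      apply le_of_eq
      congr 1
      rw [ENNReal.toReal_ofNat]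
      ring
  have hB : BddAbove ((norm ∘ F) '' verticalClosedStrip 0 1) := by
    refine ⟨∑ j, ‖a j‖, ?_⟩
    rintro _ ⟨ζ, hζ, rfl⟩
    refine (norm_sum_le _ _).trans (Finset.sum_le_sum fun j _ => ?_)
    rw [norm_mul, norm_prod]
    exact mul_le_of_le_one_right (norm_nonneg _)
      (Finset.prod_le_one (fun _ _ => norm_nonneg _) fun i _ => hg1 ζ hζ.2 i (j i))
  have h2r : 2 / r ≤ 1 := (div_le_one hr0).2 hr
  have key := norm_le_interp_of_mem_verticalClosedStrip₀₁' F (z := ((2 / r : ℝ) : ℂ))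
    ⟨by rw [ofReal_re]; positivity, by rw [ofReal_re]; exact h2r⟩ hFd.diffContOnCl hB h0 h1
  rwa [hFθ, ofReal_re] at key

end Form

/-! ### Luxemburg norms and arithmetic of the exponents. -/

theorem luxemburgNorm_le {Ω : Type*} [MeasurableSpace Ω] {φ : ℝ → ℝ} {μ : Measure Ω} {f : Ω → ℝ}
    {ε : ℝ} (hε : 0 < ε) (h : ∫⁻ ω, ENNReal.ofReal (φ (|f ω| / ε)) ∂μ ≤ 1) :
    luxemburgNorm φ μ f ≤ ENNReal.ofReal ε :=
  iInf₂_le ε ⟨hε, h⟩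

/-- On a probability space the `-1` in the Orlicz function integrates to `-1`, so the bound `1`
becomes `2`. -/
theorem luxemburgNorm_expOrlicz_le {Ω : Type*} [MeasurableSpace Ω] {μ : Measure Ω}
    [IsProbabilityMeasure μ] {r : ℝ} {f : Ω → ℝ} {ε : ℝ} (hε : 0 < ε)
    (h : ∫⁻ ω, ENNReal.ofReal (Real.exp ((|f ω| / ε) ^ r)) ∂μ ≤ 2) :
    luxemburgNorm (expOrlicz r) μ f ≤ ENNReal.ofReal ε := by
  refine luxemburgNorm_le hε ?_
  have h1 : ∀ ω, ENNReal.ofReal (Real.exp ((|f ω| / ε) ^ r)) =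
      ENNReal.ofReal (expOrlicz r (|f ω| / ε)) + 1 := by
    intro ω
    rw [← ENNReal.ofReal_one, ← ENNReal.ofReal_add _ zero_le_one, expOrlicz, sub_add_cancel]
    exact sub_nonneg.2 (Real.one_le_exp (by positivity))
  simp_rw [h1] at h
  rw [lintegral_add_right _ measurable_const, lintegral_const, measure_univ, one_mul,
    ← one_add_one_eq_two] at h
  exact (ENNReal.add_le_add_iff_right ENNReal.one_ne_top).1 h

theorem luxemburgNorm_expOrlicz_zero {Ω : Type*} [MeasurableSpace Ω] (μ : Measure Ω) {r : ℝ}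
    (hr : r ≠ 0) : luxemburgNorm (expOrlicz r) μ (fun _ => 0) = 0 := by
  refine le_antisymm (ENNReal.le_of_forall_pos_le_add fun δ hδ _ => ?_) (zero_le)
  rw [zero_add]
  refine (luxemburgNorm_le (ε := δ) (by exact_mod_cast hδ) ?_).trans (by simp)
  simp [expOrlicz, Real.zero_rpow hr]

/-- Exponents are compared through reciprocals, where conjugation is affine. At `p = 1` both sides
are `0`, by `∞.toReal = 0` and `1 / 0 = 0`. -/
theorem one_div_toReal_max_conjExp {p : ℝ≥0∞} (hp : 1 ≤ p) :
    1 / (max 2 (conjExp p)).toReal = min (1 / 2) (1 - (p⁻¹).toReal) := by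
  have h1 : (conjExp p)⁻¹ = 1 - p⁻¹ := inv_inv _
  have h2 : (1 - p⁻¹).toReal = 1 - (p⁻¹).toReal := by
    rw [ENNReal.toReal_sub_of_le (ENNReal.inv_le_one.2 hp) ENNReal.one_ne_top, ENNReal.toReal_one]
  rw [one_div, ← ENNReal.toReal_inv, ← h2, ← h1]
  rcases le_total 2 (conjExp p) with h | h
  · rw [max_eq_right h, min_eq_right]
    have := ENNReal.toReal_mono (by simp) (ENNReal.inv_le_inv.2 h)
    simpa using this
  · rw [max_eq_left h, min_eq_left]
    · simp
    · have := ENNReal.toReal_mono (by simp [h1]) (ENNReal.inv_le_inv.2 h)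
      simpa using this

section RExp

variable {m : ℕ} {p : Fin m → ℝ≥0∞}

theorem exists_one_div_rExp (hm : 0 < m) (hp : ∀ i, 1 ≤ p i) :
    ∃ k, 1 / (rExp p).toReal = min (1 / 2) (1 - ((p k)⁻¹).toReal) := by
  have : Nonempty (Fin m) := ⟨⟨0, hm⟩⟩
  obtain ⟨k, hk⟩ := exists_eq_ciInf_of_finite (f := fun k => max 2 (conjExp (p k)))
  exact ⟨k, by rw [rExp, ← hk, one_div_toReal_max_conjExp (hp k)]⟩

theorem min_le_one_div_rExp (hp : ∀ i, 1 ≤ p i) (i : Fin m) :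
    min (1 / 2) (1 - ((p i)⁻¹).toReal) ≤ 1 / (rExp p).toReal := by
  rw [← one_div_toReal_max_conjExp (hp i), one_div, one_div, ← ENNReal.toReal_inv,
    ← ENNReal.toReal_inv]
  refine ENNReal.toReal_mono ?_ (ENNReal.inv_le_inv.2 (iInf_le _ i))
  rw [Ne, ENNReal.inv_eq_top]
  have : 2 ≤ rExp p := le_iInf fun k => le_max_left _ _
  exact (zero_lt_two.trans_le this).ne'

/-- Some `p i ≠ 1` makes `rExp p` finite, so that `toReal` does not collapse it to `0`. -/
theorem two_le_toReal_rExp (hp : ∀ i, 1 ≤ p i) (hp1 : ∃ i, p i ≠ 1) : 2 ≤ (rExp p).toReal := by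
  obtain ⟨i, hi⟩ := hp1
  have h0 : ((p i)⁻¹).toReal < 1 := by
    have := ENNReal.toReal_strict_mono ENNReal.one_ne_top
      (ENNReal.inv_lt_one.2 (lt_of_le_of_ne (hp i) hi.symm))
    simpa using this
  have h1 : 0 < 1 / (rExp p).toReal :=
    (lt_min (by norm_num) (by linarith)).trans_le (min_le_one_div_rExp hp i)
  obtain ⟨k, hk⟩ := exists_one_div_rExp i.pos hp
  have h2 : 1 / (rExp p).toReal ≤ 1 / 2 := hk ▸ min_le_left _ _
  exact (one_div_le_one_div (one_div_pos.1 h1) (by norm_num)).1 h2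

/-- A minimum above `2` forces every conjugate exponent to be at least `rExp p`, hence every `p i`
to be at most its conjugate. -/
theorem bound_of_two_lt_rExp (hp : ∀ i, 1 ≤ p i) (hr : 2 < (rExp p).toReal) (i : Fin m) :
    p i ≠ ∞ ∧ (p i).toReal * (1 - 1 / (rExp p).toReal) ≤ 1 := by
  have h1 : 1 / (rExp p).toReal < 1 / 2 := one_div_lt_one_div_of_lt (by norm_num) hr
  have h2 : 1 - 1 / (rExp p).toReal ≤ ((p i)⁻¹).toReal := by
    have := min_le_one_div_rExp hp i
    rcases min_le_iff.1 this with h | h <;> linarith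
  have h3 : p i ≠ ∞ := by
    intro h
    rw [h, ENNReal.inv_top, ENNReal.toReal_zero] at h2
    linarith
  refine ⟨h3, ?_⟩
  have h4 : 0 < (p i).toReal := ENNReal.toReal_pos (zero_lt_one.trans_le (hp i)).ne' h3
  calc (p i).toReal * (1 - 1 / (rExp p).toReal) ≤ (p i).toReal * ((p i)⁻¹).toReal := by gcongr
    _ = 1 := by rw [ENNReal.toReal_inv, mul_inv_cancel₀ h4.ne']

/-- With `x = 1 / p k` at the minimizing index, `min (1/2) (1 - x) + max (1/2 - x) 0 = 1 - x`: this
matches the gain from aligning signs in the variable `k`. -/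
theorem exists_one_div_rExp_add_dimExp (hm : 0 < m) (hp : ∀ i, 1 ≤ p i) :
    ∃ k, 1 / (rExp p).toReal + dimExp (p k) = 1 - ((p k)⁻¹).toReal := by
  obtain ⟨k, hk⟩ := exists_one_div_rExp hm hp
  refine ⟨k, ?_⟩
  rw [hk, dimExp]
  rcases le_total ((p k)⁻¹).toReal (1 / 2) with h | h
  · rw [min_eq_left (by linarith), max_eq_left (by linarith)]
    ring
  · rw [min_eq_right (by linarith), max_eq_right (by linarith), add_zero]

end RExp

/-! ### The upper estimate. -/

/-- `2 N ≤ 2 ^ L` for the cardinality `N` of the net. -/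
theorem rpow_inv_card_le {m D N : ℝ} {L : ℝ} (hm : 1 ≤ m) (hD : 1 ≤ D) (hN0 : 0 < N)
    (hN : N ≤ (1 + 4 * m) ^ (2 * D)) (hL : L = 8 * (D * (1 + Real.log m))) :
    (2 * N) ^ (1 / L) ≤ 2 := by
  have hlm : 0 ≤ Real.log m := Real.log_nonneg hm
  have hL0 : 0 < L := by rw [hL]; positivity
  rw [one_div, Real.rpow_inv_le_iff_of_pos (by positivity) (by norm_num) hL0,
    ← Real.log_le_log_iff (by positivity) (by positivity), Real.log_rpow (by norm_num),
    Real.log_mul (by norm_num) hN0.ne']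
  have h1 : Real.log N ≤ 2 * D * Real.log (1 + 4 * m) := by
    rw [← Real.log_rpow (by positivity)]
    exact Real.log_le_log hN0 hN
  have h2 : Real.log (1 + 4 * m) ≤ 3 * Real.log 2 + Real.log m := by
    have h3 : 3 * Real.log 2 + Real.log m = Real.log (2 ^ 3 * m) := by
      rw [Real.log_mul (by norm_num) (by positivity), Real.log_pow]
      norm_num
    rw [h3]
    exact Real.log_le_log (by positivity) (by linarith)
  have h4 := Real.log_two_gt_d9
  have h5 : 2 * D * Real.log (1 + 4 * m) ≤ 2 * D * (3 * Real.log 2 + Real.log m) := by gcongr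
  have h6 : 0 ≤ D * Real.log m := by positivity
  have h7 : D * Real.log m * 1 ≤ D * Real.log m * (2 * Real.log 2) := by gcongr; linarith
  have h8 : 1 * Real.log 2 ≤ D * Real.log 2 := by gcongr
  -- Since `1 + 4 m ≤ 8 m`, `log (2 N)` is at most `7 D log 2 + 2 D log m`, and `2 log 2 ≥ 1` fits
  -- this into `L log 2`.
  rw [hL]
  nlinarith

theorem IsSubgaussianWith.mono {Ω : Type*} [MeasurableSpace Ω] {μ : Measure Ω} {f : Ω → ℂ} {s t : ℝ}
    (h : IsSubgaussianWith f s μ) (hs : 0 ≤ s)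
    (hst : s ≤ t) : IsSubgaussianWith f t μ := fun z =>
  ⟨(h z).1, (h z).2.trans (Real.exp_le_exp.2 (by gcongr))⟩

section Upper

variable {m : ℕ} {n : Fin m → ℕ} {p : Fin m → ℝ≥0∞}
  {Ω : Type*} [MeasurableSpace Ω] {μ : Measure Ω} [IsProbabilityMeasure μ]
  {γ : (∀ i, Fin (n i)) → Ω → ℂ} {c : (∀ i, Fin (n i)) → ℂ} {s S : ℝ}

theorem lintegral_exp_sq_formNorm_le (hm : 0 < m) (hp : ∀ i, 1 ≤ p i) (hn : ∀ i, 0 < n i)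
    (hs : 0 < s) (hS : 0 < S) (hγ : ∀ j, AEMeasurable (γ j) μ) (hind : iIndepFun γ μ)
    (hsub : ∀ j, IsSubgaussianWith (γ j) s μ) (hc : ∀ j, ‖c j‖ ≤ S) {ε : ℝ}
    (hε : ε = 16 * s * √((1 + Real.log m) * ∑ i, (n i : ℝ)) *
      (S * ∏ i, (n i : ℝ) ^ dimExp (p i))) :
    ∫⁻ ω, ENNReal.ofReal (Real.exp ((formNorm ℂ p (fun j => γ j ω * c j) / ε) ^ 2)) ∂μ ≤ 2 := by
  obtain ⟨F, hF1, hFcard, hF⟩ := exists_finset_formNorm_le (n := n) hm hp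
  have hm1 : (1 : ℝ) ≤ m := by exact_mod_cast hm
  have hlm : 0 ≤ Real.log m := Real.log_nonneg hm1
  have hnpos : ∀ i, (0 : ℝ) < n i := fun i => by exact_mod_cast hn i
  set D : ℝ := ∑ i, (n i : ℝ) with hD
  have hD1 : 1 ≤ D := by
    have h1 : (1 : ℝ) ≤ n ⟨0, hm⟩ := by exact_mod_cast hn ⟨0, hm⟩
    exact h1.trans (Finset.single_le_sum (f := fun i => (n i : ℝ)) (fun i _ => (hnpos i).le)
      (Finset.mem_univ _))
  set σ : ℝ := S * ∏ i, (n i : ℝ) ^ dimExp (p i) with hσ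
  have hσ0 : 0 < σ := mul_pos hS (Finset.prod_pos fun i _ => Real.rpow_pos_of_pos (hnpos i) _)
  set v : ℝ := s ^ 2 * σ ^ 2 with hv
  have hv0 : 0 < v := by positivity
  set L : ℝ := 8 * (D * (1 + Real.log m)) with hL
  have hL8 : 1 ≤ L := by
    have : 1 ≤ D * (1 + Real.log m) := one_le_mul_of_one_le_of_one_le hD1 (by linarith)
    linarith
  have hL0 : 0 < L := by linarith
  have hε0 : 0 < ε := by rw [hε]; positivity
  -- The factors are `4` from the squared net constant `2`, `8 v` from the square moment, and `L`
  -- from the root.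
  have hε2 : ε ^ 2 = 32 * v * L := by
    rw [hε, mul_pow, mul_pow, Real.sq_sqrt (by positivity)]
    ring
  have hNne : F.Nonempty := by
    obtain ⟨z, hz, -⟩ := hF 0
    exact ⟨z, hz⟩
  have hN0 : (0 : ℝ) < F.card := by exact_mod_cast hNne.card_pos
  set Q : ℝ := 2 * F.card with hQ
  have hQ0 : 0 < Q := by positivity
  have hQL : Q ^ (1 / L) ≤ 2 := by
    refine rpow_inv_card_le hm1 hD1 hN0 ?_ hL
    refine hFcard.trans (le_of_eq ?_)
    rw [← Real.rpow_natCast, hD]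
    push_cast
    rfl
  let b : (∀ i, PiLp (p i) (fun _ : Fin (n i) => ℂ)) → (∀ i, Fin (n i)) → ℂ :=
    fun z j => c j * ∏ i, RCLike.map ℂ ℂ (z i (j i))
  have hval : ∀ z ω, formValue ℂ p (fun j => γ j ω * c j) z = ∑ j, γ j ω * b z j := by
    intro z ω
    exact Finset.sum_congr rfl fun j _ => by rw [mul_assoc]
  let G : Ω → ℝ := fun ω => ∑ z ∈ F, Real.exp (‖∑ j, γ j ω * b z j‖ ^ 2 / (8 * v))
  have hG0 : ∀ ω, 0 ≤ G ω := fun ω => Finset.sum_nonneg fun z _ => (Real.exp_pos _).le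
  have hGint : ∫⁻ ω, ENNReal.ofReal (G ω) ∂μ ≤ ENNReal.ofReal Q := by
    simp only [G]
    simp_rw [ENNReal.ofReal_sum_of_nonneg (s := F) fun z _ => (Real.exp_pos _).le]
    rw [lintegral_finsetSum' _ fun z _ => by fun_prop]
    calc _ ≤ ∑ z ∈ F, (2 : ℝ≥0∞) := by
          refine Finset.sum_le_sum fun z hz => ?_
          refine lintegral_exp_norm_sq_sum_le hind hsub hv0 ?_
          rw [hv]
          gcongr
          exact sum_sq_coeff_le hn hp hc (hF1 z hz)
      _ = ENNReal.ofReal Q := by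
          rw [Finset.sum_const, nsmul_eq_mul, hQ, mul_comm, ENNReal.ofReal_mul (by norm_num),
            ENNReal.ofReal_natCast, ENNReal.ofReal_ofNat]
  -- `t ↦ A t + B` is the tangent of the concave function `t ^ (1 / L)` at `t = Q`. Weighted AM-GM
  -- thus acts as Jensen's inequality, and `A Q + B = Q ^ (1 / L)`.
  set A : ℝ := Q ^ (1 / L) * (1 / L) / Q with hA
  set B : ℝ := Q ^ (1 / L) * (1 - 1 / L) with hB
  have h1L : 1 / L ≤ 1 := (div_le_one hL0).2 hL8
  have hA0 : 0 ≤ A := by positivity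
  have hB0 : 0 ≤ B := mul_nonneg (by positivity) (by linarith)
  have hpt : ∀ ω, Real.exp ((formNorm ℂ p (fun j => γ j ω * c j) / ε) ^ 2) ≤ A * G ω + B := by
    intro ω
    obtain ⟨z, hz, hfz⟩ := hF fun j => γ j ω * c j
    rw [hval] at hfz
    have h1 : (formNorm ℂ p (fun j => γ j ω * c j) / ε) ^ 2 ≤
        ‖∑ j, γ j ω * b z j‖ ^ 2 / (8 * v) * (1 / L) := by
      have h2 : ‖∑ j, γ j ω * b z j‖ ^ 2 / (8 * v) * (1 / L) =
          (2 * ‖∑ j, γ j ω * b z j‖) ^ 2 / ε ^ 2 := by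
        rw [hε2]
        field_simp
        ring
      rw [h2, div_pow]
      have := formNorm_nonneg (𝕂 := ℂ) (p := p) fun j => γ j ω * c j
      gcongr
    calc _ ≤ Real.exp (‖∑ j, γ j ω * b z j‖ ^ 2 / (8 * v) * (1 / L)) := Real.exp_le_exp.2 h1
      _ = Real.exp (‖∑ j, γ j ω * b z j‖ ^ 2 / (8 * v)) ^ (1 / L) := Real.exp_mul _ _
      _ ≤ G ω ^ (1 / L) := by
        gcongr
        exact Finset.single_le_sum
          (f := fun z => Real.exp (‖∑ j, γ j ω * b z j‖ ^ 2 / (8 * v)))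
          (fun z _ => (Real.exp_pos _).le) hz
      _ = Q ^ (1 / L) * ((G ω / Q) ^ (1 / L) * 1 ^ (1 - 1 / L)) := by
        rw [Real.one_rpow, mul_one, Real.div_rpow (hG0 ω) hQ0.le,
          mul_div_cancel₀ _ (Real.rpow_pos_of_pos hQ0 _).ne']
      _ ≤ Q ^ (1 / L) * (1 / L * (G ω / Q) + (1 - 1 / L) * 1) := by
        gcongr
        exact Real.geom_mean_le_arith_mean2_weighted (by positivity) (by linarith)
          (div_nonneg (hG0 ω) hQ0.le) zero_le_one (by ring)
      _ = A * G ω + B := by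
        rw [hA, hB]
        ring
  calc ∫⁻ ω, ENNReal.ofReal (Real.exp ((formNorm ℂ p (fun j => γ j ω * c j) / ε) ^ 2)) ∂μ
      ≤ ∫⁻ ω, (ENNReal.ofReal A * ENNReal.ofReal (G ω) + ENNReal.ofReal B) ∂μ := by
        refine lintegral_mono fun ω => ?_
        rw [← ENNReal.ofReal_mul hA0, ← ENNReal.ofReal_add (mul_nonneg hA0 (hG0 ω)) hB0]
        exact ENNReal.ofReal_le_ofReal (hpt ω)
    _ = ENNReal.ofReal A * ∫⁻ ω, ENNReal.ofReal (G ω) ∂μ + ENNReal.ofReal B := by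
        rw [lintegral_add_right _ measurable_const, lintegral_const_mul' _ _ ENNReal.ofReal_ne_top,
          lintegral_const, measure_univ, mul_one]
    _ ≤ ENNReal.ofReal A * ENNReal.ofReal Q + ENNReal.ofReal B := by gcongr
    _ = ENNReal.ofReal (Q ^ (1 / L)) := by
        rw [← ENNReal.ofReal_mul hA0, ← ENNReal.ofReal_add (by positivity) hB0, hA, hB]
        congr 1
        field_simp
        ring
    _ ≤ 2 := by
        rw [← ENNReal.ofReal_ofNat]
        exact ENNReal.ofReal_le_ofReal hQL

variable {𝕂 : Type*} [RCLike 𝕂]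

theorem luxemburgNorm_formNorm_le_of_two (hm : 0 < m) (hp : ∀ i, 1 ≤ p i) (hn : ∀ i, 0 < n i)
    (hs : 0 < s) (hS : 0 < S) (hγ : ∀ j, AEMeasurable (γ j) μ) (hind : iIndepFun γ μ)
    (hsub : ∀ j, IsSubgaussianWith (γ j) s μ) (hc : ∀ j, ‖c j‖ ≤ S) :
    luxemburgNorm (expOrlicz 2) μ (fun ω => formNorm 𝕂 p fun j => γ j ω * c j) ≤
      ENNReal.ofReal (16 * s * √((1 + Real.log m) * ∑ i, (n i : ℝ)) *
        (S * ∏ i, (n i : ℝ) ^ dimExp (p i))) := by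
  have hlm : 0 ≤ Real.log m := Real.log_natCast_nonneg m
  have hnpos : ∀ i, (0 : ℝ) < n i := fun i => by exact_mod_cast hn i
  have : Nonempty (Fin m) := ⟨⟨0, hm⟩⟩
  have hD : 0 < ∑ i, (n i : ℝ) := Finset.sum_pos (fun i _ => hnpos i) Finset.univ_nonempty
  have hP : 0 < ∏ i, (n i : ℝ) ^ dimExp (p i) :=
    Finset.prod_pos fun i _ => Real.rpow_pos_of_pos (hnpos i) _
  refine luxemburgNorm_expOrlicz_le (by positivity) ?_
  refine (lintegral_mono fun ω => ENNReal.ofReal_le_ofReal (Real.exp_le_exp.2 ?_)).trans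
    (lintegral_exp_sq_formNorm_le hm hp hn hs hS hγ hind hsub hc rfl)
  rw [abs_of_nonneg (formNorm_nonneg _), Real.rpow_two]
  have := formNorm_nonneg (𝕂 := 𝕂) (p := p) fun j => γ j ω * c j
  have := formNorm_le_formNorm_complex (𝕂 := 𝕂) hp fun j => γ j ω * c j
  gcongr

/-- Here `p` is at most the conjugate of `r ≥ 2`, hence at most `2`; for `r > 2` the product in the
upper estimate is therefore `1`. -/
theorem dimExp_eq_zero {p : ℝ≥0∞} {r : ℝ} (hp0 : 1 ≤ p) (hp : p ≠ ∞) (hr : 2 ≤ r)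
    (h : p.toReal * (1 - 1 / r) ≤ 1) : dimExp p = 0 := by
  have h1 : 0 < p.toReal := ENNReal.toReal_pos (zero_lt_one.trans_le hp0).ne' hp
  have h2 : 1 / r ≤ 1 / 2 := one_div_le_one_div_of_le (by norm_num) hr
  have h3 : p.toReal ≤ 2 := by nlinarith
  rw [dimExp, ENNReal.toReal_inv, max_eq_right]
  have := inv_anti₀ h1 h3
  linarith

theorem luxemburgNorm_formNorm_le_of_two_lt {M r : ℝ} (hr : 2 < r) (hm : 0 < m)
    (hp : ∀ i, 1 ≤ p i)
    (hpr : ∀ i, p i ≠ ∞ ∧ (p i).toReal * (1 - 1 / r) ≤ 1) (hn : ∀ i, 0 < n i)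
    (hs : 0 < s) (hM : 0 < M) (hS : 0 < S) (hγ : ∀ j, AEMeasurable (γ j) μ) (hind : iIndepFun γ μ)
    (hsub : ∀ j, IsSubgaussianWith (γ j) s μ) (hbd : ∀ j, ∀ᵐ ω ∂μ, ‖γ j ω‖ ≤ M)
    (hc : ∀ j, ‖c j‖ ≤ S) :
    luxemburgNorm (expOrlicz r) μ (fun ω => formNorm 𝕂 p fun j => γ j ω * c j) ≤
      ENNReal.ofReal ((M * S) ^ (1 - 2 / r) *
        (16 * s * √((1 + Real.log m) * ∑ i, (n i : ℝ)) * S) ^ (2 / r)) := by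
  have hlm : 0 ≤ Real.log m := Real.log_natCast_nonneg m
  have hnpos : ∀ i, (0 : ℝ) < n i := fun i => by exact_mod_cast hn i
  have : Nonempty (Fin m) := ⟨⟨0, hm⟩⟩
  have hD : 0 < ∑ i, (n i : ℝ) := Finset.sum_pos (fun i _ => hnpos i) Finset.univ_nonempty
  have hr0 : 0 < r := by linarith
  have h2 := lintegral_exp_sq_formNorm_le (p := fun _ => 2) hm (fun _ => by norm_num) hn hs hS hγ
    hind hsub hc rfl
  have hd2 : dimExp 2 = 0 := by simp [dimExp]
  simp only [hd2, Real.rpow_zero, Finset.prod_const_one, mul_one] at h2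
  set ε : ℝ := 16 * s * √((1 + Real.log m) * ∑ i, (n i : ℝ)) * S with hε
  have hε0 : 0 < ε := by positivity
  refine luxemburgNorm_expOrlicz_le (by positivity) ?_
  refine (lintegral_mono_ae ?_).trans h2
  filter_upwards [ae_all_iff.2 hbd] with ω hω
  refine ENNReal.ofReal_le_ofReal (Real.exp_le_exp.2 ?_)
  rw [abs_of_nonneg (formNorm_nonneg _)]
  set f := formNorm 𝕂 p fun j => γ j ω * c j with hf
  set g := formNorm ℂ (fun _ => 2) fun j => γ j ω * c j with hg
  have hf0 : 0 ≤ f := formNorm_nonneg _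
  have hg0 : 0 ≤ g := formNorm_nonneg _
  -- The almost sure bound on the variables controls the `ℓ_1` endpoint; the `ℓ_2` endpoint `g`
  -- carries the randomness.
  have hfg : f ≤ (M * S) ^ (1 - 2 / r) * g ^ (2 / r) := by
    refine (formNorm_le_formNorm_complex hp _).trans
      (formNorm_le_interp hr.le hp (fun i => (hpr i).1) (fun i => (hpr i).2) (by positivity) ?_)
    intro j
    rw [norm_mul]
    have := hω j
    have := hc j
    gcongr
  calc (f / ((M * S) ^ (1 - 2 / r) * ε ^ (2 / r))) ^ r
      ≤ ((M * S) ^ (1 - 2 / r) * g ^ (2 / r) / ((M * S) ^ (1 - 2 / r) * ε ^ (2 / r))) ^ r := by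
        gcongr
    _ = ((g / ε) ^ (2 / r)) ^ r := by
        rw [mul_div_mul_left _ _ (by positivity), Real.div_rpow hg0 hε0.le]
    _ = (g / ε) ^ 2 := by
        rw [← Real.rpow_mul (by positivity), div_mul_cancel₀ _ hr0.ne', Real.rpow_two]

/-- The constant in the upper estimate. -/
noncomputable def upperConst (r s M : ℝ) : ℝ :=
  if r = 2 then 16 * (s + 1) else (M + 1) ^ (1 - 2 / r) * (16 * (s + 1)) ^ (2 / r)

theorem upperConst_pos {r s M : ℝ} (hs : 0 ≤ s) (hM : 0 ≤ M) : 0 < upperConst r s M := by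
  unfold upperConst
  split_ifs <;> positivity

theorem luxemburgNorm_formNorm_le {M r : ℝ} (hr : 2 ≤ r) (hp : ∀ i, 1 ≤ p i)
    (hp1 : ∃ i, p i ≠ 1) (hpr : (rExp p).toReal = r) (hn : ∀ i, 0 < n i)
    (hs : 0 ≤ s) (hM : 0 ≤ M) (hγ : ∀ j, AEMeasurable (γ j) μ) (hind : iIndepFun γ μ)
    (hsub : ∀ j, IsSubgaussianWith (γ j) s μ) (hbd : 2 < r → ∀ j, ∀ᵐ ω ∂μ, ‖γ j ω‖ ≤ M) :
    luxemburgNorm (expOrlicz r) μ (fun ω => formNorm 𝕂 p fun j => γ j ω * c j) ≤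
      ENNReal.ofReal (upperConst r s M * (1 + Real.log m) ^ (1 / r) * (⨆ j, ‖c j‖) *
        (∑ i, (n i : ℝ)) ^ (1 / r) * ∏ i, (n i : ℝ) ^ dimExp (p i)) := by
  have hm : 0 < m := hp1.choose.pos
  have hr0 : 0 < r := by linarith
  have hc : ∀ j, ‖c j‖ ≤ ⨆ j, ‖c j‖ := fun j =>
    le_ciSup (f := fun j => ‖c j‖) (Set.finite_range _).bddAbove j
  have hS0 : 0 ≤ ⨆ j, ‖c j‖ := Real.iSup_nonneg fun _ => norm_nonneg _
  have hlm : 0 ≤ Real.log m := Real.log_natCast_nonneg m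
  have hD : 0 ≤ ∑ i, (n i : ℝ) := Finset.sum_nonneg fun i _ => Nat.cast_nonneg _
  -- `s` and `M` may vanish; enlarging them by `1` keeps the candidate `ε` in the Luxemburg norm
  -- positive.
  have hsub' : ∀ j, IsSubgaussianWith (γ j) (s + 1) μ := fun j => (hsub j).mono hs (by linarith)
  set S := ⨆ j, ‖c j‖ with hS
  rcases hS0.eq_or_lt with h0 | h0
  · have hc0 : ∀ j, c j = 0 := fun j => norm_le_zero_iff.1 ((hc j).trans h0.symm.le)
    have hf : (fun ω => formNorm 𝕂 p fun j => γ j ω * c j) = fun _ => 0 := by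
      funext ω
      simp [formNorm, formValue, hc0]
    rw [hf, luxemburgNorm_expOrlicz_zero μ hr0.ne']
    exact zero_le
  rcases hr.eq_or_lt with rfl | hr2
  · refine (luxemburgNorm_formNorm_le_of_two hm hp hn (by positivity : 0 < s + 1) h0 hγ hind hsub'
      hc).trans (le_of_eq ?_)
    rw [upperConst, if_pos rfl, Real.sqrt_eq_rpow, Real.mul_rpow (by positivity) hD]
    congr 1
    ring
  · have hpr' : ∀ i, p i ≠ ∞ ∧ (p i).toReal * (1 - 1 / r) ≤ 1 := fun i => by
      have := bound_of_two_lt_rExp hp (hpr.symm ▸ hr2) i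
      rwa [hpr] at this
    refine (luxemburgNorm_formNorm_le_of_two_lt hr2 hm hp hpr' hn (by positivity : 0 < s + 1)
      (by positivity : 0 < M + 1) h0 hγ hind hsub'
      (fun j => (hbd hr2 j).mono fun ω h => h.trans (by linarith)) hc).trans (le_of_eq ?_)
    have hdim : ∀ i, dimExp (p i) = 0 := fun i =>
      dimExp_eq_zero (hp i) (hpr' i).1 hr (hpr' i).2
    simp only [hdim, Real.rpow_zero, Finset.prod_const_one, mul_one]
    rw [upperConst, if_neg hr2.ne', Real.mul_rpow (by positivity) h0.le,
      Real.mul_rpow (by positivity) h0.le, Real.mul_rpow (by positivity) (by positivity),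
      Real.sqrt_eq_rpow, ← Real.rpow_mul (by positivity), Real.mul_rpow (by positivity) hD]
    have h1 : (1 / 2 : ℝ) * (2 / r) = 1 / r := by ring
    have h2 : S ^ (1 - 2 / r) * S ^ (2 / r) = S := by
      rw [← Real.rpow_add h0, sub_add_cancel, Real.rpow_one]
    rw [h1]
    congr 1
    calc _ = (M + 1) ^ (1 - 2 / r) * (16 * (s + 1)) ^ (2 / r) * (1 + Real.log m) ^ (1 / r) *
          (S ^ (1 - 2 / r) * S ^ (2 / r)) * (∑ i, (n i : ℝ)) ^ (1 / r) := by ring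
      _ = _ := by rw [h2]

end Upper

/-! ### Khinchine's inequality for sums over signs. -/

/-- The sign `±1` attached to a Boolean. -/
def boolSign (b : Bool) : ℝ := if b then 1 else -1

theorem abs_boolSign (b : Bool) : |boolSign b| = 1 := by
  cases b <;> simp [boolSign]

theorem sum_boolSign_succ {n : ℕ} (x : Fin (n + 1) → ℝ) (φ : ℝ → ℝ) :
    ∑ ε : Fin (n + 1) → Bool, φ (∑ t, boolSign (ε t) * x t) =
      ∑ ε : Fin n → Bool, (φ (x 0 + ∑ t, boolSign (ε t) * x t.succ) +
        φ (-x 0 + ∑ t, boolSign (ε t) * x t.succ)) := by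
  rw [← (Fin.consEquiv fun _ => Bool).sum_comp, Fintype.sum_prod_type, Finset.sum_add_distrib]
  simp [Fin.consEquiv, Fin.sum_univ_succ, boolSign]

theorem sum_boolSign_sq {n : ℕ} (x : Fin n → ℝ) :
    ∑ ε : Fin n → Bool, (∑ t, boolSign (ε t) * x t) ^ 2 = 2 ^ n * ∑ t, x t ^ 2 := by
  induction n with
  | zero => simp
  | succ n ih =>
    rw [sum_boolSign_succ x (· ^ 2), Fin.sum_univ_succ, pow_succ]
    have h : ∀ ε : Fin n → Bool, (x 0 + ∑ t, boolSign (ε t) * x t.succ) ^ 2 +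
        (-x 0 + ∑ t, boolSign (ε t) * x t.succ) ^ 2 =
        2 * x 0 ^ 2 + 2 * (∑ t, boolSign (ε t) * x t.succ) ^ 2 := fun ε => by ring
    simp only [h]
    simp only [Finset.sum_add_distrib, ← Finset.mul_sum]
    rw [ih fun t => x t.succ]
    simp
    ring

/-- Averaging over one sign kills the odd powers, and `a⁴ + 6 a² V + 3 V² ≤ 3 (a² + V)²` closes the
induction. -/
theorem sum_boolSign_pow_four_le {n : ℕ} (x : Fin n → ℝ) :
    ∑ ε : Fin n → Bool, (∑ t, boolSign (ε t) * x t) ^ 4 ≤ 2 ^ n * (3 * (∑ t, x t ^ 2) ^ 2) := by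
  induction n with
  | zero => simp
  | succ n ih =>
    rw [sum_boolSign_succ x (· ^ 4), Fin.sum_univ_succ, pow_succ]
    have h : ∀ ε : Fin n → Bool, (x 0 + ∑ t, boolSign (ε t) * x t.succ) ^ 4 +
        (-x 0 + ∑ t, boolSign (ε t) * x t.succ) ^ 4 =
        2 * x 0 ^ 4 + 12 * x 0 ^ 2 * (∑ t, boolSign (ε t) * x t.succ) ^ 2 +
          2 * (∑ t, boolSign (ε t) * x t.succ) ^ 4 := fun ε => by ring
    simp only [h]
    simp only [Finset.sum_add_distrib, ← Finset.mul_sum]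
    rw [sum_boolSign_sq fun t => x t.succ]
    have h1 := ih fun t => x t.succ
    have h2 : ∑ _ε : Fin n → Bool, x 0 ^ 4 = 2 ^ n * x 0 ^ 4 := by simp
    rw [h2]
    have h3 : 0 ≤ (2 : ℝ) ^ n * x 0 ^ 4 := by positivity
    nlinarith

/-- **Khinchine's inequality** for the first absolute moment. -/
theorem sqrt_sum_sq_le_sum_boolSign {n : ℕ} (x : Fin n → ℝ) :
    2 ^ n * (1 / 4 * √(∑ t, x t ^ 2)) ≤ ∑ ε : Fin n → Bool, |∑ t, boolSign (ε t) * x t| := by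
  set V := ∑ t, x t ^ 2 with hV
  have hV0 : 0 ≤ V := Finset.sum_nonneg fun t _ => sq_nonneg _
  rcases hV0.eq_or_lt with h0 | h0
  · rw [← h0]
    simpa using Finset.sum_nonneg fun ε _ => abs_nonneg _
  set σ := √V with hσ
  have hσ0 : 0 < σ := Real.sqrt_pos.2 h0
  have hσ2 : σ ^ 2 = V := Real.sq_sqrt hV0
  -- With `u = |X| / σ` this says `u² - u⁴ / 4 ≤ u`. Averaging, with second moment `σ²` and fourth
  -- at most `3 σ⁴`, leaves `σ - 3 σ / 4`.
  have hpt : ∀ X : ℝ, X ^ 2 / σ - X ^ 4 / (4 * σ ^ 3) ≤ |X| := by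
    intro X
    have hX : X ^ 2 / σ - X ^ 4 / (4 * σ ^ 3) =
        |X| * ((|X| / σ) - (|X| / σ) ^ 3 / 4) := by
      have h2 : X ^ 4 = |X| ^ 4 := by rw [← abs_pow, abs_of_nonneg (by positivity)]
      rw [← sq_abs, h2]
      field_simp
    rw [hX]
    refine mul_le_of_le_one_right (abs_nonneg _) ?_
    have hu : 0 ≤ |X| / σ := by positivity
    nlinarith [mul_nonneg hu (sq_nonneg (|X| / σ - 1)), sq_nonneg (|X| / σ - 1)]
  calc 2 ^ n * (1 / 4 * σ) = (2 ^ n * V) / σ - (2 ^ n * (3 * V ^ 2)) / (4 * σ ^ 3) := by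
        rw [← hσ2]
        field_simp
        ring
    _ ≤ (∑ ε : Fin n → Bool, (∑ t, boolSign (ε t) * x t) ^ 2) / σ -
        (∑ ε : Fin n → Bool, (∑ t, boolSign (ε t) * x t) ^ 4) / (4 * σ ^ 3) := by
        rw [sum_boolSign_sq]
        have := sum_boolSign_pow_four_le x
        gcongr
    _ = ∑ ε : Fin n → Bool, ((∑ t, boolSign (ε t) * x t) ^ 2 / σ -
        (∑ t, boolSign (ε t) * x t) ^ 4 / (4 * σ ^ 3)) := by
        rw [Finset.sum_sub_distrib, Finset.sum_div, Finset.sum_div]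
    _ ≤ _ := Finset.sum_le_sum fun ε _ => hpt _

theorem sum_abs_le_sum_boolSign {n : ℕ} (hn : 0 < n) (x : Fin n → ℝ) :
    2 ^ n * (1 / 4 * ((n : ℝ) ^ (-(1 / 2) : ℝ) * ∑ t, |x t|)) ≤
      ∑ ε : Fin n → Bool, |∑ t, boolSign (ε t) * x t| := by
  refine le_trans ?_ (sqrt_sum_sq_le_sum_boolSign x)
  gcongr
  refine Real.le_sqrt_of_sq_le ?_
  have hn0 : (0 : ℝ) < n := by exact_mod_cast hn
  have h1 : ((n : ℝ) ^ (-(1 / 2) : ℝ)) ^ 2 = (n : ℝ)⁻¹ := by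
    rw [← Real.rpow_natCast, ← Real.rpow_mul hn0.le, ← Real.rpow_neg_one]
    norm_num
  have h2 := sq_sum_le_card_mul_sum_sq (s := Finset.univ) (f := fun t => |x t|)
  simp only [sq_abs, Finset.card_univ, Fintype.card_fin] at h2
  rw [mul_pow, h1, inv_mul_le_iff₀ hn0]
  exact h2

theorem sum_norm_le_sum_boolSign {n : ℕ} (hn : 0 < n) (x : Fin n → ℂ) :
    2 ^ n * (1 / 8 * ((n : ℝ) ^ (-(1 / 2) : ℝ) * ∑ t, ‖x t‖)) ≤
      ∑ ε : Fin n → Bool, ‖∑ t, (boolSign (ε t) : ℂ) * x t‖ := by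
  have h1 := sum_abs_le_sum_boolSign hn fun t => (x t).re
  have h2 := sum_abs_le_sum_boolSign hn fun t => (x t).im
  have hre : ∀ ε : Fin n → Bool,
      (∑ t, (boolSign (ε t) : ℂ) * x t).re = ∑ t, boolSign (ε t) * (x t).re := fun ε => by
    rw [Complex.re_sum]
    simp
  have him : ∀ ε : Fin n → Bool,
      (∑ t, (boolSign (ε t) : ℂ) * x t).im = ∑ t, boolSign (ε t) * (x t).im := fun ε => by
    rw [Complex.im_sum]
    simp
  have h3 : ∑ ε : Fin n → Bool, |∑ t, boolSign (ε t) * (x t).re| ≤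
      ∑ ε : Fin n → Bool, ‖∑ t, (boolSign (ε t) : ℂ) * x t‖ :=
    Finset.sum_le_sum fun ε _ => hre ε ▸ Complex.abs_re_le_norm _
  have h4 : ∑ ε : Fin n → Bool, |∑ t, boolSign (ε t) * (x t).im| ≤
      ∑ ε : Fin n → Bool, ‖∑ t, (boolSign (ε t) : ℂ) * x t‖ :=
    Finset.sum_le_sum fun ε _ => him ε ▸ Complex.abs_im_le_norm _
  have h5 : ∑ t, ‖x t‖ ≤ ∑ t, |(x t).re| + ∑ t, |(x t).im| := by
    rw [← Finset.sum_add_distrib]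
    exact Finset.sum_le_sum fun t _ => Complex.norm_le_abs_re_add_abs_im _
  have h6 : (2 : ℝ) ^ n * (1 / 8 * ((n : ℝ) ^ (-(1 / 2) : ℝ) * ∑ t, ‖x t‖)) ≤
      2 ^ n * (1 / 8 * ((n : ℝ) ^ (-(1 / 2) : ℝ) * (∑ t, |(x t).re| + ∑ t, |(x t).im|))) := by
    gcongr
  linarith

/-! ### Deterministic lower bound for the norm of a form. -/

/-- A vector with coordinates of modulus at most `n ^ (-1 / p)` is in the unit ball of `ℓ_p^n`. -/
theorem PiLp.norm_le_one_of_abs_le {n : ℕ} (hn : 0 < n) {p : ℝ≥0∞} (hp : 1 ≤ p) {z : Fin n → ℝ}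
    (hz : ∀ t, |z t| ≤ (n : ℝ) ^ (-(p⁻¹).toReal)) : ‖(WithLp.toLp p z : PiLp p _)‖ ≤ 1 := by
  have hn0 : (0 : ℝ) < n := by exact_mod_cast hn
  rcases eq_or_ne p ∞ with rfl | hp'
  · rw [PiLp.norm_le_one_iff_forall]
    simpa using hz
  · have h0 : 0 < p.toReal := ENNReal.toReal_pos (zero_lt_one.trans_le hp).ne' hp'
    rw [PiLp.norm_le_one_iff_sum_rpow hp hp']
    calc ∑ t, ‖z t‖ ^ p.toReal ≤ ∑ _t : Fin n, ((n : ℝ) ^ (-(p⁻¹).toReal)) ^ p.toReal := by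
          refine Finset.sum_le_sum fun t _ => ?_
          rw [Real.norm_eq_abs]
          exact Real.rpow_le_rpow (abs_nonneg _) (hz t) h0.le
      _ = 1 := by
          rw [← Real.rpow_mul hn0.le, ENNReal.toReal_inv, neg_mul, inv_mul_cancel₀ h0.ne',
            Real.rpow_neg_one]
          simp [hn0.ne']

/-- One vector must serve the whole family, so it is chosen by averaging: over coordinate vectors
for `p ≤ 2`, and over sign vectors scaled by `n ^ (-1/p)`, with Khinchine's inequality, for `p ≥ 2`.
-/
theorem exists_unitBall_family_le {n : ℕ} (hn : 0 < n) {p : ℝ≥0∞} (hp : 1 ≤ p) {ι : Type*}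
    [Fintype ι] (x : ι → Fin n → ℂ) :
    ∃ z : Fin n → ℝ, ‖(WithLp.toLp p z : PiLp p _)‖ ≤ 1 ∧
      1 / 8 * (n : ℝ) ^ dimExp p * ((n : ℝ)⁻¹ * ∑ l, ∑ t, ‖x l t‖) ≤
        ∑ l, ‖∑ t, (z t : ℂ) * x l t‖ := by
  have hn0 : (0 : ℝ) < n := by exact_mod_cast hn
  have : Nonempty (Fin n) := ⟨⟨0, hn⟩⟩
  have hX : 0 ≤ ∑ l, ∑ t, ‖x l t‖ :=
    Finset.sum_nonneg fun l _ => Finset.sum_nonneg fun t _ => norm_nonneg _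
  rcases le_total (1 / 2) ((p⁻¹).toReal) with h | h
  · have hd : dimExp p = 0 := max_eq_right (by linarith)
    have : Fact (1 ≤ p) := ⟨hp⟩
    obtain ⟨t₀, -, ht₀⟩ := Finset.exists_le_of_sum_le (s := (Finset.univ : Finset (Fin n)))
      (f := fun _ => (n : ℝ)⁻¹ * ∑ l, ∑ t, ‖x l t‖) (g := fun t => ∑ l, ‖x l t‖)
      Finset.univ_nonempty (by
        rw [Finset.sum_comm (s := (Finset.univ : Finset (Fin n)))]
        simp [hn0.ne'])
    refine ⟨Pi.single t₀ 1, by simp, ?_⟩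
    have h1 : ∀ l, ∑ t, ((Pi.single t₀ 1 : Fin n → ℝ) t : ℂ) * x l t = x l t₀ := fun l => by
      rw [Finset.sum_eq_single t₀]
      · simp
      · intro t _ ht
        simp [ht]
      · simp
    simp only [h1, hd, Real.rpow_zero]
    have : 0 ≤ (n : ℝ)⁻¹ * ∑ l, ∑ t, ‖x l t‖ := by positivity
    linarith
  · have hd : dimExp p = 1 / 2 - (p⁻¹).toReal := max_eq_left (by linarith)
    set κ : ℝ := (n : ℝ) ^ (-(p⁻¹).toReal) with hκ
    have hκ0 : 0 < κ := by positivity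
    obtain ⟨ε, -, hε⟩ := Finset.exists_le_of_sum_le
      (s := (Finset.univ : Finset (Fin n → Bool)))
      (f := fun _ => 1 / 8 * ((n : ℝ) ^ (-(1 / 2) : ℝ) * ∑ l, ∑ t, ‖x l t‖))
      (g := fun ε => ∑ l, ‖∑ t, (boolSign (ε t) : ℂ) * x l t‖)
      Finset.univ_nonempty (by
        rw [Finset.sum_comm (s := (Finset.univ : Finset (Fin n → Bool)))]
        calc _ = ∑ l, 2 ^ n * (1 / 8 * ((n : ℝ) ^ (-(1 / 2) : ℝ) * ∑ t, ‖x l t‖)) := by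
              simp only [← Finset.mul_sum]
              simp
              ring
          _ ≤ _ := Finset.sum_le_sum fun l _ => sum_norm_le_sum_boolSign hn (x l))
    refine ⟨fun t => κ * boolSign (ε t), PiLp.norm_le_one_of_abs_le hn hp fun t => ?_, ?_⟩
    · rw [abs_mul, abs_boolSign, mul_one, abs_of_pos hκ0]
    · have h1 : ∀ l, ‖∑ t, ((κ * boolSign (ε t) : ℝ) : ℂ) * x l t‖ =
          κ * ‖∑ t, (boolSign (ε t) : ℂ) * x l t‖ := fun l => by
        have h2 : ∑ t, ((κ * boolSign (ε t) : ℝ) : ℂ) * x l t =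
            (κ : ℂ) * ∑ t, (boolSign (ε t) : ℂ) * x l t := by
          rw [Finset.mul_sum]
          exact Finset.sum_congr rfl fun t _ => by rw [Complex.ofReal_mul, mul_assoc]
        rw [h2, norm_mul, Complex.norm_real, Real.norm_eq_abs, abs_of_pos hκ0]
      simp only [h1]
      rw [← Finset.mul_sum]
      have h3 : (n : ℝ) ^ dimExp p * (n : ℝ)⁻¹ = κ * (n : ℝ) ^ (-(1 / 2) : ℝ) := by
        rw [hd, hκ, ← Real.rpow_neg_one, ← Real.rpow_add hn0, ← Real.rpow_add hn0]
        congr 1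
        ring
      calc 1 / 8 * (n : ℝ) ^ dimExp p * ((n : ℝ)⁻¹ * ∑ l, ∑ t, ‖x l t‖)
          = 1 / 8 * ((n : ℝ) ^ dimExp p * (n : ℝ)⁻¹) * ∑ l, ∑ t, ‖x l t‖ := by ring
        _ = κ * (1 / 8 * ((n : ℝ) ^ (-(1 / 2) : ℝ) * ∑ l, ∑ t, ‖x l t‖)) := by
          rw [h3]
          ring
        _ ≤ _ := by gcongr

/-- For a single functional the signs can be aligned with the real or the imaginary parts; the
larger of the two sums costs the factor `1 / 2`. -/
theorem exists_unitBall_le {n : ℕ} (hn : 0 < n) {p : ℝ≥0∞} (hp : 1 ≤ p) (x : Fin n → ℂ) :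
    ∃ z : Fin n → ℝ, ‖(WithLp.toLp p z : PiLp p _)‖ ≤ 1 ∧
      1 / 2 * ((n : ℝ) ^ (-(p⁻¹).toReal) * ∑ t, ‖x t‖) ≤ ‖∑ t, (z t : ℂ) * x t‖ := by
  set κ : ℝ := (n : ℝ) ^ (-(p⁻¹).toReal) with hκ
  have hn0 : (0 : ℝ) < n := by exact_mod_cast hn
  have hκ0 : 0 < κ := by positivity
  have key : ∀ u : Fin n → ℝ, ∃ z : Fin n → ℝ, ‖(WithLp.toLp p z : PiLp p _)‖ ≤ 1 ∧
      ∑ t, z t * u t = κ * ∑ t, |u t| := by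
    intro u
    refine ⟨fun t => κ * boolSign (decide (0 ≤ u t)),
      PiLp.norm_le_one_of_abs_le hn hp fun t => ?_, ?_⟩
    · rw [abs_mul, abs_boolSign, mul_one, abs_of_pos hκ0]
    · rw [Finset.mul_sum]
      refine Finset.sum_congr rfl fun t _ => ?_
      rw [mul_assoc]
      congr 1
      by_cases h : 0 ≤ u t
      · simp [boolSign, h, abs_of_nonneg h]
      · simp [boolSign, h, abs_of_neg (not_le.1 h)]
  have hx : ∑ t, ‖x t‖ ≤ ∑ t, |(x t).re| + ∑ t, |(x t).im| := by
    rw [← Finset.sum_add_distrib]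
    exact Finset.sum_le_sum fun t _ => Complex.norm_le_abs_re_add_abs_im _
  rcases le_total (∑ t, |(x t).re|) (∑ t, |(x t).im|) with h | h
  · obtain ⟨z, hz, hzu⟩ := key fun t => (x t).im
    refine ⟨z, hz, ?_⟩
    have h1 : (∑ t, (z t : ℂ) * x t).im = κ * ∑ t, |(x t).im| := by
      rw [← hzu, Complex.im_sum]
      simp
    refine le_trans ?_ ((le_abs_self _).trans (Complex.abs_im_le_norm _))
    rw [h1]
    nlinarith
  · obtain ⟨z, hz, hzu⟩ := key fun t => (x t).re
    refine ⟨z, hz, ?_⟩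
    have h1 : (∑ t, (z t : ℂ) * x t).re = κ * ∑ t, |(x t).re| := by
      rw [← hzu, Complex.re_sum]
      simp
    refine le_trans ?_ ((le_abs_self _).trans (Complex.abs_re_le_norm _))
    rw [h1]
    nlinarith

/-- The map `(j, t) ↦ (update j i t, j i)` is an involution, hence preserves the sum over all pairs.
-/
theorem sum_sum_update {ι α : Type*} [Fintype ι] [DecidableEq ι] [Fintype α] (i : ι)
    (F : (ι → α) → ℝ) :
    ∑ j : ι → α, ∑ t, F (Function.update j i t) = Fintype.card α * ∑ j, F j := by
  have hinv : Function.Involutive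
      (fun q : (ι → α) × α => (Function.update q.1 i q.2, q.1 i)) := by
    intro q
    simp
  rw [← Fintype.sum_prod_type' (f := fun j t => F (Function.update j i t)),
    ← Equiv.sum_comp hinv.toPerm, Finset.mul_sum, Fintype.sum_prod_type]
  simp

/-- The `m`-linear form with coefficients `a` on real vectors. -/
noncomputable def realFormMap {m n : ℕ} (a : (Fin m → Fin n) → ℂ) :
    MultilinearMap ℝ (fun _ : Fin m => Fin n → ℝ) ℂ :=
  ∑ j : Fin m → Fin n, a j • (MultilinearMap.mkPiAlgebra ℝ (Fin m) ℂ).compLinearMap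
    fun i => Complex.ofRealCLM.toLinearMap ∘ₗ LinearMap.proj (j i)

theorem realFormMap_apply {m n : ℕ} (a : (Fin m → Fin n) → ℂ) (z : Fin m → Fin n → ℝ) :
    realFormMap a z = ∑ j : Fin m → Fin n, a j * ∏ i, (z i (j i) : ℂ) := by
  simp [realFormMap]

theorem realFormMap_single {m n : ℕ} (a : (Fin m → Fin n) → ℂ) (j : Fin m → Fin n) :
    realFormMap a (fun i => Pi.single (j i) 1) = a j := by
  rw [realFormMap_apply, Finset.sum_eq_single j]
  · simp
  · intro k _ hk
    obtain ⟨i, hi⟩ := Function.ne_iff.1 hk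
    rw [Finset.prod_eq_zero (Finset.mem_univ i), mul_zero]
    simp [hi]
  · simp

theorem MultilinearMap.map_update_eq_sum {m n : ℕ}
    (A : MultilinearMap ℝ (fun _ : Fin m => Fin n → ℝ) ℂ) (y : Fin m → Fin n → ℝ) (i : Fin m)
    (w : Fin n → ℝ) :
    A (Function.update y i w) = ∑ t, (w t : ℂ) * A (Function.update y i (Pi.single t 1)) := by
  have hw : w = ∑ t, w t • (Pi.single t 1 : Fin n → ℝ) := by
    simpa using pi_eq_sum_univ' w
  conv_lhs => rw [hw]
  rw [A.map_update_sum]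
  refine Finset.sum_congr rfl fun t _ => ?_
  rw [A.map_update_smul, Complex.real_smul]

/-- Basis vectors are replaced one variable at a time, by a vector independent of `j`. The sum keeps
running over all `j`, including the entries in `S` that no longer matter, so the factor `1 / n` of
the family lemma cancels. -/
theorem exists_unitBall_piecewise_le {m n : ℕ} (hn : 0 < n) {p : Fin m → ℝ≥0∞}
    (hp : ∀ i, 1 ≤ p i) (A : MultilinearMap ℝ (fun _ : Fin m => Fin n → ℝ) ℂ)
    (S : Finset (Fin m)) :
    ∃ z : Fin m → Fin n → ℝ, (∀ i, ‖(WithLp.toLp (p i) (z i) : PiLp (p i) _)‖ ≤ 1) ∧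
      (∏ i ∈ S, (1 / 8 * (n : ℝ) ^ dimExp (p i))) *
          ∑ j : Fin m → Fin n, ‖A fun i => Pi.single (j i) 1‖ ≤
        ∑ j : Fin m → Fin n, ‖A (S.piecewise z fun i => Pi.single (j i) 1)‖ := by
  induction S using Finset.induction_on with
  | empty =>
    refine ⟨0, fun i => ?_, by simp⟩
    have : Fact (1 ≤ p i) := ⟨hp i⟩
    simp
  | insert i S hi ih =>
    have hn0 : (0 : ℝ) < n := by exact_mod_cast hn
    obtain ⟨z, hz, hS⟩ := ih
    obtain ⟨w, hw, hle⟩ := exists_unitBall_family_le hn (hp i)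
      fun (j : Fin m → Fin n) t =>
        A (Function.update (S.piecewise z fun i => Pi.single (j i) 1) i (Pi.single t 1))
    refine ⟨Function.update z i w, fun k => ?_, ?_⟩
    · rcases eq_or_ne k i with rfl | hk
      · rwa [Function.update_self]
      · rw [Function.update_of_ne hk]
        exact hz k
    have h1 : ∀ j : Fin m → Fin n,
        (insert i S).piecewise (Function.update z i w) (fun i => Pi.single (j i) 1) =
          Function.update (S.piecewise z fun i => Pi.single (j i) 1) i w := by
      intro j
      funext k
      rcases eq_or_ne k i with rfl | hk
      · simp
      · simp [Finset.piecewise, hk]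
    have h2 : ∀ (j : Fin m → Fin n) t,
        Function.update (S.piecewise z fun i => (Pi.single (j i) 1 : Fin n → ℝ)) i
          (Pi.single t 1) = S.piecewise z fun k => Pi.single (Function.update j i t k) 1 := by
      intro j t
      funext k
      rcases eq_or_ne k i with rfl | hk
      · simp [Finset.piecewise, hi]
      · simp [Finset.piecewise, hk]
    simp only [h1, A.map_update_eq_sum _ i w]
    refine le_trans ?_ hle
    simp only [h2]
    rw [sum_sum_update i fun j => ‖A (S.piecewise z fun k => Pi.single (j k) 1)‖, Fintype.card_fin,
      inv_mul_cancel_left₀ hn0.ne', Finset.prod_insert hi, mul_assoc]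
    gcongr

/-- The norm of an `m`-linear form is bounded from below by the mean modulus of its
coefficients. -/
theorem mul_sum_norm_le_formNorm {𝕂 : Type*} [RCLike 𝕂] {m n : ℕ} (hm : 0 < m) (hn : 0 < n)
    {p : Fin m → ℝ≥0∞} (hp : ∀ i, 1 ≤ p i) (a : (Fin m → Fin n) → ℂ) :
    1 / 2 * (1 / 8) ^ m * (n : ℝ) ^ (1 / (rExp p).toReal + ∑ i, dimExp (p i)) *
      (((n : ℝ) ^ m)⁻¹ * ∑ j, ‖a j‖) ≤ formNorm 𝕂 (n := fun _ => n) p a := by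
  have hn0 : (0 : ℝ) < n := by exact_mod_cast hn
  obtain ⟨k, hk⟩ := exists_one_div_rExp_add_dimExp hm hp
  obtain ⟨z, hz, hS⟩ :=
    exists_unitBall_piecewise_le hn hp (realFormMap a) (Finset.univ.erase k)
  obtain ⟨w, hw, hle⟩ := exists_unitBall_le hn (hp k)
    fun t => realFormMap a (Function.update z k (Pi.single t 1))
  rw [← MultilinearMap.map_update_eq_sum] at hle
  simp only [realFormMap_single] at hS
  have h1 : ∀ (j : Fin m → Fin n) t, (Finset.univ.erase k).piecewise z
      (fun i => (Pi.single (Function.update j k t i) 1 : Fin n → ℝ)) =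
        Function.update z k (Pi.single t 1) := by
    intro j t
    funext i
    rcases eq_or_ne i k with rfl | hi
    · simp [Finset.piecewise]
    · simp [Finset.piecewise, hi]
  -- With every variable but `k` fixed, the summand depends only on the entry at `k`, so the sum
  -- over `j` reduces to a multiple of a sum over `t`.
  have h2 := sum_sum_update k fun j =>
    ‖realFormMap a ((Finset.univ.erase k).piecewise z fun i => Pi.single (j i) 1)‖
  simp only [h1, Finset.sum_const, Finset.card_univ, Fintype.card_fun, Fintype.card_fin,
    nsmul_eq_mul, Nat.cast_pow] at h2
  have hval : ‖realFormMap a (Function.update z k w)‖ ≤ formNorm 𝕂 (n := fun _ => n) p a := by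
    set y := Function.update z k w with hy
    have hyb : ∀ i, ‖(WithLp.toLp (p i) (y i) : PiLp (p i) _)‖ ≤ 1 := by
      intro i
      rcases eq_or_ne i k with rfl | hi
      · rwa [hy, Function.update_self]
      · rw [hy, Function.update_of_ne hi]
        exact hz i
    have hy' : realFormMap a y = formValue 𝕂 (n := fun _ => n) p a
        fun i => WithLp.toLp (p i) fun t => ((y i t : ℝ) : 𝕂) := by
      rw [realFormMap_apply, formValue]
      simp [RCLike.map_apply]
    rw [hy']
    refine norm_formValue_le_formNorm hp a fun i => ?_
    exact PiLp.norm_le_one_of_norm_le (hp i) (fun t => by simp) (hyb i)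
  refine le_trans ?_ (hle.trans hval)
  set X := ∑ t, ‖realFormMap a (Function.update z k (Pi.single t 1))‖ with hX
  set Y := ∑ j : Fin m → Fin n,
    ‖realFormMap a ((Finset.univ.erase k).piecewise z fun i => Pi.single (j i) 1)‖ with hY
  have hXY : X = ((n : ℝ) ^ m)⁻¹ * (n * Y) := by
    rw [← h2, inv_mul_cancel_left₀ (by positivity)]
  have hexp : (n : ℝ) ^ (1 / (rExp p).toReal + ∑ i, dimExp (p i)) =
      (n : ℝ) ^ (-((p k)⁻¹).toReal) * n * ∏ i ∈ Finset.univ.erase k, (n : ℝ) ^ dimExp (p i) := by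
    rw [← Finset.add_sum_erase _ _ (Finset.mem_univ k), ← add_assoc, hk, Real.rpow_add hn0,
      Real.rpow_sum_of_pos hn0, sub_eq_neg_add, Real.rpow_add hn0, Real.rpow_one]
  have hcard : (1 / 8 : ℝ) ^ m ≤ (1 / 8 : ℝ) ^ (Finset.univ.erase k).card := by
    refine pow_le_pow_of_le_one (by norm_num) (by norm_num) ?_
    simp
  rw [Finset.prod_mul_distrib, Finset.prod_const] at hS
  have hP : 0 ≤ ∏ i ∈ Finset.univ.erase k, (n : ℝ) ^ dimExp (p i) :=
    Finset.prod_nonneg fun i _ => by positivity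
  have hA : 0 ≤ ∑ j, ‖a j‖ := Finset.sum_nonneg fun _ _ => norm_nonneg _
  rw [hXY, hexp]
  calc _ = 1 / 2 * ((n : ℝ) ^ (-((p k)⁻¹).toReal) * (((n : ℝ) ^ m)⁻¹ * (n *
        ((1 / 8) ^ m * (∏ i ∈ Finset.univ.erase k, (n : ℝ) ^ dimExp (p i)) *
          ∑ j, ‖a j‖)))) := by ring
    _ ≤ 1 / 2 * ((n : ℝ) ^ (-((p k)⁻¹).toReal) * (((n : ℝ) ^ m)⁻¹ * (n *
        ((1 / 8) ^ (Finset.univ.erase k).card *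
          (∏ i ∈ Finset.univ.erase k, (n : ℝ) ^ dimExp (p i)) * ∑ j, ‖a j‖)))) := by gcongr
    _ ≤ _ := by gcongr

/-! ### First moments, and the four model laws. -/

/-- The first absolute moment is bounded by the exponential Orlicz norm. -/
theorem lintegral_le_two_mul_luxemburgNorm {Ω : Type*} [MeasurableSpace Ω] {μ : Measure Ω}
    [IsProbabilityMeasure μ] {r : ℝ} (hr : 1 ≤ r) (f : Ω → ℝ) :
    ∫⁻ ω, ENNReal.ofReal |f ω| ∂μ ≤ 2 * luxemburgNorm (expOrlicz r) μ f := by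
  have h2 : (2 : ℝ≥0∞) ≠ 0 := by simp
  have h2' : (2 : ℝ≥0∞) ≠ ∞ := by simp
  rw [mul_comm, ← ENNReal.div_le_iff h2 h2']
  refine le_iInf₂ fun ε hε => ?_
  rw [ENNReal.div_le_iff h2 h2']
  have hpt : ∀ t : ℝ, 0 ≤ t → t ≤ 1 + expOrlicz r t := by
    intro t ht
    rw [expOrlicz, add_sub_cancel]
    rcases le_total t 1 with h | h
    · exact h.trans (Real.one_le_exp (by positivity))
    · calc t = t ^ (1 : ℝ) := (Real.rpow_one t).symm
        _ ≤ t ^ r := Real.rpow_le_rpow_of_exponent_le h hr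
        _ ≤ t ^ r + 1 := by linarith
        _ ≤ Real.exp (t ^ r) := Real.add_one_le_exp _
  have hpt' : ∀ ω, ENNReal.ofReal |f ω| ≤
      ENNReal.ofReal ε * (1 + ENNReal.ofReal (expOrlicz r (|f ω| / ε))) := by
    intro ω
    have h1 := hpt (|f ω| / ε) (div_nonneg (abs_nonneg _) hε.1.le)
    have h3 : |f ω| = ε * (|f ω| / ε) := by
      have := hε.1.ne'
      field_simp
    calc ENNReal.ofReal |f ω| = ENNReal.ofReal (ε * (|f ω| / ε)) := by rw [← h3]
      _ ≤ ENNReal.ofReal (ε * (1 + expOrlicz r (|f ω| / ε))) :=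
        ENNReal.ofReal_le_ofReal (mul_le_mul_of_nonneg_left h1 hε.1.le)
      _ ≤ _ := by
        rw [ENNReal.ofReal_mul hε.1.le]
        gcongr
        exact ENNReal.ofReal_add_le.trans (by simp)
  refine (lintegral_mono hpt').trans ?_
  rw [lintegral_const_mul' _ _ ENNReal.ofReal_ne_top, lintegral_add_left measurable_const,
    lintegral_const, measure_univ, mul_one]
  gcongr
  rw [← one_add_one_eq_two]
  gcongr
  exact hε.2

theorem isSubgaussianWith_of_hasLaw {Ω : Type*} [MeasurableSpace Ω] {μ : Measure Ω}
    {f : Ω → ℂ} {ν : Measure ℂ} {s : ℝ} (hf : HasLaw f ν μ) (h : IsSubgaussianWith (fun z => z) s ν) :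
    IsSubgaussianWith f s μ := by
  intro z
  have hm : AEStronglyMeasurable (fun w : ℂ => Real.exp (z * w).re) ν := by fun_prop
  refine ⟨?_, ?_⟩
  · have := (h z).1
    rw [← hf.map_eq] at this hm
    exact (integrable_map_measure hm hf.aemeasurable).1 this
  · have := (h z).2
    rw [← hf.integral_comp hm] at this
    exact this

/-- Hoeffding's lemma for complex variables. -/
theorem isSubgaussianWith_of_norm_le_one {Ω : Type*} [MeasurableSpace Ω] {μ : Measure Ω}
    [IsProbabilityMeasure μ] {f : Ω → ℂ} (hf : AEMeasurable f μ) (hb : ∀ᵐ ω ∂μ, ‖f ω‖ ≤ 1)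
    (h0 : ∫ ω, f ω ∂μ = 0) : IsSubgaussianWith f 1 μ := by
  intro z
  have hint : Integrable f μ :=
    Integrable.of_bound hf.aestronglyMeasurable 1 hb
  -- Real Hoeffding for `Re (z f) ∈ [-‖z‖, ‖z‖]`: half the length squared is exactly `‖z‖²`.
  have hX : HasSubgaussianMGF (fun ω => (z * f ω).re) ((‖‖z‖ - -‖z‖‖₊ / 2) ^ 2) μ := by
    refine hasSubgaussianMGF_of_mem_Icc_of_integral_eq_zero (by fun_prop) ?_ ?_
    · filter_upwards [hb] with ω hω
      have h1 : |(z * f ω).re| ≤ ‖z‖ := (Complex.abs_re_le_norm _).trans (by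
        rw [norm_mul]
        exact mul_le_of_le_one_right (norm_nonneg _) hω)
      exact abs_le.1 h1
    · have h2 := integral_re (𝕜 := ℂ) (hint.const_mul z)
      simp only [RCLike.re_to_complex] at h2
      rw [h2, integral_const_mul, h0, mul_zero, Complex.zero_re]
  have h1 := hX.integrable_exp_mul 1
  have h2 := hX.mgf_le 1
  simp only [mgf, one_mul] at h1 h2
  refine ⟨h1, h2.trans (Real.exp_le_exp.2 (le_of_eq ?_))⟩
  have h3 : ‖z‖ - -‖z‖ = 2 * ‖z‖ := by ring
  rw [h3]
  push_cast
  rw [norm_mul, norm_norm, Real.norm_ofNat]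
  ring

instance : IsProbabilityMeasure rademacherLaw :=
  ⟨by simp [rademacherLaw, ENNReal.inv_two_add_inv_two]⟩

theorem ae_norm_eq_one_rademacherLaw : ∀ᵐ z ∂rademacherLaw, ‖z‖ = 1 := by
  have hm : MeasurableSet {z : ℂ | ‖z‖ = 1} := measurableSet_eq_fun measurable_norm measurable_const
  rw [rademacherLaw, ae_add_measure_iff]
  constructor <;> refine Measure.ae_smul_measure ?_ _ <;> rw [ae_dirac_iff hm] <;> simp

theorem isSubgaussianWith_rademacherLaw : IsSubgaussianWith (fun z => z) 1 rademacherLaw := by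
  refine isSubgaussianWith_of_norm_le_one aemeasurable_id
    (ae_norm_eq_one_rademacherLaw.mono fun z h => h.le) ?_
  rw [rademacherLaw, integral_add_measure, integral_smul_measure, integral_smul_measure,
    integral_dirac, integral_dirac]
  · simp
  all_goals
    refine Integrable.smul_measure ?_ (by simp)
    exact integrable_dirac (by simp)

theorem measurable_toCircle_coe : Measurable fun t : AddCircle (1 : ℝ) => (t.toCircle : ℂ) :=
  (continuous_subtype_val.comp AddCircle.continuous_toCircle).measurable

instance : IsProbabilityMeasure steinhausLaw :=
  Measure.isProbabilityMeasure_map measurable_toCircle_coe.aemeasurable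

theorem ae_norm_eq_one_steinhausLaw : ∀ᵐ z ∂steinhausLaw, ‖z‖ = 1 := by
  have hm : MeasurableSet {z : ℂ | ‖z‖ = 1} := measurableSet_eq_fun measurable_norm measurable_const
  rw [steinhausLaw, ae_map_iff measurable_toCircle_coe.aemeasurable hm]
  exact Filter.Eventually.of_forall fun t => Circle.norm_coe t.toCircle

theorem isSubgaussianWith_steinhausLaw : IsSubgaussianWith (fun z => z) 1 steinhausLaw := by
  refine isSubgaussianWith_of_norm_le_one aemeasurable_id
    (ae_norm_eq_one_steinhausLaw.mono fun z h => h.le) ?_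
  rw [steinhausLaw, integral_map measurable_toCircle_coe.aemeasurable (by fun_prop)]
  -- The mean vanishes because a half turn changes the sign and preserves Haar measure.
  have := integral_eq_zero_of_add_right_eq_neg (μ := AddCircle.haarAddCircle (T := (1 : ℝ)))
    (fourier_add_half_inv_index (T := 1) one_ne_zero one_pos)
  simpa only [fourier_one] using this

theorem isSubgaussianWith_realGaussianLaw : IsSubgaussianWith (fun z => z) 1 realGaussianLaw := by
  have hlaw : IsSubgaussianWith (fun x : ℝ => (x : ℂ)) 1 (gaussianReal 0 1) := by
    rw [isSubgaussianWith_ofReal_iff]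
    intro x
    refine ⟨integrable_exp_mul_gaussianReal x, le_of_eq ?_⟩
    have := congrFun (mgf_fun_id_gaussianReal (μ := 0) (v := 1)) x
    rw [mgf] at this
    rw [this]
    simp
  intro z
  have hm : AEStronglyMeasurable (fun w : ℂ => Real.exp (z * w).re) realGaussianLaw := by fun_prop
  have ho : AEMeasurable (fun x : ℝ => (x : ℂ)) (gaussianReal 0 1) := by fun_prop
  rw [realGaussianLaw] at hm ⊢
  rw [integrable_map_measure hm ho, integral_map ho hm]
  exact hlaw z

theorem isSubgaussianWith_complexGaussianLaw :
    IsSubgaussianWith (fun z => z) 1 complexGaussianLaw := by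
  intro z
  have hm : AEStronglyMeasurable (fun w : ℂ => Real.exp (z * w).re) complexGaussianLaw := by
    fun_prop
  have ho : AEMeasurable (fun x : ℝ × ℝ => ((x.1 : ℂ) + (x.2 : ℂ) * Complex.I) / (√2 : ℂ))
      ((gaussianReal 0 1).prod (gaussianReal 0 1)) := by fun_prop
  rw [complexGaussianLaw] at hm ⊢
  rw [integrable_map_measure hm ho, integral_map ho hm]
  have h1 : ∀ x : ℝ × ℝ, Real.exp (z * (((x.1 : ℂ) + (x.2 : ℂ) * Complex.I) / (√2 : ℂ))).re =
      Real.exp (z.re / √2 * x.1) * Real.exp (-z.im / √2 * x.2) := by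
    intro x
    rw [← Real.exp_add, ← mul_div_assoc, Complex.div_ofReal_re]
    congr 1
    simp
    ring
  have h2 : ∀ t : ℝ, ∫ x, Real.exp (t * x) ∂(gaussianReal 0 1) = Real.exp (t ^ 2 / 2) := by
    intro t
    have := congrFun (mgf_fun_id_gaussianReal (μ := 0) (v := 1)) t
    rw [mgf] at this
    rw [this]
    simp
  have h3 : (fun x : ℝ × ℝ =>
      Real.exp (z * (((x.1 : ℂ) + (x.2 : ℂ) * Complex.I) / (√2 : ℂ))).re) =
      fun x => Real.exp (z.re / √2 * x.1) * Real.exp (-z.im / √2 * x.2) := funext h1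
  refine ⟨?_, ?_⟩
  · change Integrable (fun x : ℝ × ℝ =>
      Real.exp (z * (((x.1 : ℂ) + (x.2 : ℂ) * Complex.I) / (√2 : ℂ))).re) _
    rw [h3]
    exact (integrable_exp_mul_gaussianReal _).mul_prod (integrable_exp_mul_gaussianReal _)
  -- By independence the moment is `exp (‖z‖² / 4)`, below the allowed `exp (‖z‖² / 2)`.
  · rw [h3, integral_prod_mul (fun x => Real.exp (z.re / √2 * x))
      (fun x => Real.exp (-z.im / √2 * x)), h2, h2, ← Real.exp_add, Real.exp_le_exp, div_pow,
      div_pow, Real.sq_sqrt (by norm_num), Complex.sq_norm, Complex.normSq_apply]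
    nlinarith [sq_nonneg z.re, sq_nonneg z.im]

/-- Positivity suffices for the lower estimate, and it follows from the absence of an atom at `0`.
-/
theorem lintegral_enorm_gaussianReal_ne_zero : ∫⁻ x, ‖x‖ₑ ∂(gaussianReal 0 1) ≠ 0 := by
  intro h
  rw [lintegral_eq_zero_iff (by fun_prop)] at h
  have := nullSingletonClass_gaussianReal (μ := 0) (v := 1) one_ne_zero
  have h0 : ∀ᵐ x ∂(gaussianReal 0 1), x ∉ ({0} : Set ℝ) :=
    measure_eq_zero_iff_ae_notMem.1 (measure_singleton 0)
  obtain ⟨x, hx, hx0⟩ := (h.and h0).exists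
  exact hx0 (by simpa using hx)

theorem lintegral_enorm_realGaussianLaw :
    ∫⁻ z, ‖z‖ₑ ∂realGaussianLaw = ∫⁻ x, ‖x‖ₑ ∂(gaussianReal 0 1) := by
  rw [realGaussianLaw, lintegral_map (by fun_prop) (by fun_prop)]
  refine lintegral_congr fun x => ?_
  rw [← ofReal_norm, ← ofReal_norm, Complex.norm_real]

theorem le_lintegral_enorm_complexGaussianLaw :
    2⁻¹ * ∫⁻ x, ‖x‖ₑ ∂(gaussianReal 0 1) ≤ ∫⁻ z, ‖z‖ₑ ∂complexGaussianLaw := by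
  rw [complexGaussianLaw, lintegral_map (by fun_prop) (by fun_prop),
    lintegral_prod _ (by fun_prop), ← lintegral_const_mul' _ _ (by simp)]
  refine lintegral_mono fun x => ?_
  have hx : ∀ y : ℝ, 2⁻¹ * ‖x‖ₑ ≤ ‖((x : ℂ) + (y : ℂ) * Complex.I) / (√2 : ℂ)‖ₑ := by
    intro y
    have h2 : (2⁻¹ : ℝ≥0∞) = ENNReal.ofReal 2⁻¹ := by
      rw [ENNReal.ofReal_inv_of_pos (by norm_num), ENNReal.ofReal_ofNat]
    rw [← ofReal_norm, ← ofReal_norm, h2, ← ENNReal.ofReal_mul (by norm_num)]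
    refine ENNReal.ofReal_le_ofReal ?_
    have h3 : |x| ≤ ‖(x : ℂ) + (y : ℂ) * Complex.I‖ := by
      simpa using Complex.abs_re_le_norm ((x : ℂ) + (y : ℂ) * Complex.I)
    rw [norm_div, Complex.norm_real, Real.norm_eq_abs, Real.norm_eq_abs,
      abs_of_nonneg (Real.sqrt_nonneg 2), inv_mul_eq_div]
    have h4 : √2 ≤ 2 := by rw [Real.sqrt_le_left (by norm_num)]; norm_num
    gcongr
  calc 2⁻¹ * ‖x‖ₑ = ∫⁻ _y, 2⁻¹ * ‖x‖ₑ ∂(gaussianReal 0 1) := by simp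
    _ ≤ _ := lintegral_mono hx

theorem lintegral_enorm_eq_one {ν : Measure ℂ} [IsProbabilityMeasure ν]
    (h : ∀ᵐ z ∂ν, ‖z‖ = 1) : ∫⁻ z, ‖z‖ₑ ∂ν = 1 := by
  rw [lintegral_congr_ae (g := fun _ => 1)]
  · simp
  · filter_upwards [h] with z hz
    rw [← ofReal_norm, hz, ENNReal.ofReal_one]

/-- The first absolute moments of Rademacher, Steinhaus and Gaussian variables are bounded from
below. -/
theorem exists_pos_le_lintegral_enorm :
    ∃ a : ℝ, 0 < a ∧ ∀ (Ω : Type*) [MeasurableSpace Ω] (μ : Measure Ω) (f : Ω → ℂ),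
      (HasLaw f rademacherLaw μ ∨ HasLaw f steinhausLaw μ ∨ HasLaw f realGaussianLaw μ ∨
        HasLaw f complexGaussianLaw μ) → ENNReal.ofReal a ≤ ∫⁻ ω, ‖f ω‖ₑ ∂μ := by
  have h0 : 0 < min 1 (2⁻¹ * ∫⁻ x, ‖x‖ₑ ∂(gaussianReal 0 1)) :=
    lt_min one_pos (ENNReal.mul_pos (by simp) lintegral_enorm_gaussianReal_ne_zero)
  obtain ⟨a, ha0, ha⟩ := ENNReal.lt_iff_exists_nnreal_btwn.1 h0
  refine ⟨a, by exact_mod_cast ha0, fun Ω _ μ f hf => ?_⟩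
  rw [ENNReal.ofReal_coe_nnreal]
  have ha1 := ha.le.trans (min_le_left _ _)
  have ha2 := ha.le.trans (min_le_right _ _)
  rcases hf with hf | hf | hf | hf <;>
    rw [hf.lintegral_comp (f := fun z => ‖z‖ₑ) (by fun_prop)]
  · rwa [lintegral_enorm_eq_one ae_norm_eq_one_rademacherLaw]
  · rwa [lintegral_enorm_eq_one ae_norm_eq_one_steinhausLaw]
  · rw [lintegral_enorm_realGaussianLaw]
    refine ha2.trans (mul_le_of_le_one_left zero_le ?_)
    simp
  · exact ha2.trans le_lintegral_enorm_complexGaussianLaw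

/-- A form with independent Rademacher, Steinhaus or Gaussian coefficients has a large first
moment. -/
theorem le_luxemburgNorm_formNorm {𝕂 Ω : Type*} [RCLike 𝕂] [MeasurableSpace Ω] {μ : Measure Ω}
    [IsProbabilityMeasure μ] {m n : ℕ} (hn : 0 < n) {p : Fin m → ℝ≥0∞} (hp : ∀ i, 1 ≤ p i)
    (hp1 : ∃ i, p i ≠ 1) {γ : (Fin m → Fin n) → Ω → ℂ} {c : (Fin m → Fin n) → ℂ} {a : ℝ}
    (ha : 0 < a) (hγ : ∀ j, AEMeasurable (γ j) μ)
    (hγa : ∀ j, ENNReal.ofReal a ≤ ∫⁻ ω, ‖γ j ω‖ₑ ∂μ) (hc : ∀ j, ‖c j‖ = 1) :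
    ENNReal.ofReal (a * (1 / 4 * (1 / 8) ^ m) *
        (n : ℝ) ^ (1 / (rExp p).toReal + ∑ i, dimExp (p i))) ≤
      luxemburgNorm (expOrlicz (rExp p).toReal) μ
        (fun ω => formNorm 𝕂 (n := fun _ => n) p fun j => γ j ω * c j) := by
  have hm : 0 < m := hp1.choose.pos
  have hr := two_le_toReal_rExp hp hp1
  have hn0 : (0 : ℝ) < n := by exact_mod_cast hn
  have h1 := lintegral_le_two_mul_luxemburgNorm (μ := μ) (by linarith : 1 ≤ (rExp p).toReal)
    fun ω => formNorm 𝕂 (n := fun _ => n) p fun j => γ j ω * c j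
  set E : ℝ := (n : ℝ) ^ (1 / (rExp p).toReal + ∑ i, dimExp (p i)) with hE
  have hE0 : 0 < E := Real.rpow_pos_of_pos hn0 _
  set κ : ℝ := 1 / 2 * (1 / 8) ^ m * E * ((n : ℝ) ^ m)⁻¹ with hκ
  have hκ0 : 0 < κ := by positivity
  have h2 : ∀ ω, ENNReal.ofReal κ * ∑ j, ‖γ j ω‖ₑ ≤
      ENNReal.ofReal |formNorm 𝕂 (n := fun _ => n) p fun j => γ j ω * c j| := by
    intro ω
    have h3 := mul_sum_norm_le_formNorm (𝕂 := 𝕂) hm hn hp fun j => γ j ω * c j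
    simp only [norm_mul, hc, mul_one] at h3
    have h4 : ∑ j, ‖γ j ω‖ₑ = ENNReal.ofReal (∑ j, ‖γ j ω‖) := by
      rw [ENNReal.ofReal_sum_of_nonneg fun _ _ => norm_nonneg _]
      simp only [ofReal_norm]
    rw [h4, ← ENNReal.ofReal_mul hκ0.le]
    refine ENNReal.ofReal_le_ofReal (le_trans (le_of_eq ?_) (h3.trans (le_abs_self _)))
    rw [hκ]
    ring
  have h5 : ENNReal.ofReal (κ * ((n : ℝ) ^ m * a)) ≤
      ∫⁻ ω, ENNReal.ofReal |formNorm 𝕂 (n := fun _ => n) p fun j => γ j ω * c j| ∂μ := by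
    refine le_trans ?_ (lintegral_mono h2)
    rw [lintegral_const_mul' _ _ ENNReal.ofReal_ne_top,
      lintegral_finsetSum' _ fun j _ => (hγ j).enorm, ENNReal.ofReal_mul hκ0.le]
    gcongr
    calc ENNReal.ofReal ((n : ℝ) ^ m * a) = ∑ _j : Fin m → Fin n, ENNReal.ofReal a := by
          rw [Finset.sum_const, Finset.card_univ, Fintype.card_fun, Fintype.card_fin,
            Fintype.card_fin, nsmul_eq_mul, ENNReal.ofReal_mul (by positivity), ← Nat.cast_pow,
            ENNReal.ofReal_natCast]
      _ ≤ _ := Finset.sum_le_sum fun j _ => hγa j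
  have h6 := h5.trans h1
  -- The factor `2` is what comparing the first moment with the Orlicz norm costs; it turns `1 / 2`
  -- into `1 / 4`.
  have h7 : κ * ((n : ℝ) ^ m * a) = 2 * (a * (1 / 4 * (1 / 8) ^ m) * E) := by
    rw [hκ]
    field_simp
    ring
  rw [h7, ENNReal.ofReal_mul (by norm_num), ENNReal.ofReal_ofNat] at h6
  exact (ENNReal.mul_le_mul_iff_right (by simp) (by simp)).1 h6

/-! ### Both estimates together. -/

theorem mainTheorem7 :
    -- the upper estimate, with a constant that depends only on `r`, `s` and, if `2 < r`, on `M`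
    (∀ r s M : ℝ, 2 ≤ r → 0 ≤ s → 0 ≤ M → ∃ C : ℝ, 0 < C ∧
      ∀ (m : ℕ) (p : Fin m → ℝ≥0∞), (∀ i, 1 ≤ p i) → (∃ i, p i ≠ 1) → (rExp p).toReal = r →
      ∀ (n : Fin m → ℕ), (∀ i, 0 < n i) →
      ∀ (𝕂 : Type*) [RCLike 𝕂] (Ω : Type*) [MeasurableSpace Ω] (μ : Measure Ω)
        [IsProbabilityMeasure μ] (γ : (∀ i, Fin (n i)) → Ω → ℂ) (c : (∀ i, Fin (n i)) → ℂ),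
        (∀ j, AEMeasurable (γ j) μ) → iIndepFun γ μ → (∀ j, IsSubgaussianWith (γ j) s μ) →
        (2 < r → ∀ j, ∀ᵐ ω ∂μ, ‖γ j ω‖ ≤ M) →
        luxemburgNorm (expOrlicz r) μ (fun ω => formNorm 𝕂 p fun j => γ j ω * c j) ≤
          ENNReal.ofReal (C * (1 + Real.log m) ^ (1 / r) * (⨆ j, ‖c j‖) *
            (∑ i, (n i : ℝ)) ^ (1 / r) * ∏ i, (n i : ℝ) ^ dimExp (p i))) ∧
    -- its optimality in `n = n_1 = ⋯ = n_m`, with constants that depend only on `m` and `p`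
    (∀ (m : ℕ) (p : Fin m → ℝ≥0∞), (∀ i, 1 ≤ p i) → (∃ i, p i ≠ 1) →
      ∃ A B : ℝ, 0 < A ∧ 0 < B ∧
      ∀ n : ℕ, 0 < n →
      ∀ (𝕂 : Type*) [RCLike 𝕂] (Ω : Type*) [MeasurableSpace Ω] (μ : Measure Ω)
        [IsProbabilityMeasure μ] (γ : (Fin m → Fin n) → Ω → ℂ) (c : (Fin m → Fin n) → ℂ),
        iIndepFun γ μ →
        (∀ j, HasLaw (γ j) rademacherLaw μ ∨ HasLaw (γ j) steinhausLaw μ ∨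
          (rExp p = 2 ∧ (HasLaw (γ j) realGaussianLaw μ ∨ HasLaw (γ j) complexGaussianLaw μ))) →
        (∀ j, ‖c j‖ = 1) →
        ENNReal.ofReal (A * (n : ℝ) ^ (1 / (rExp p).toReal + ∑ i, dimExp (p i))) ≤
          luxemburgNorm (expOrlicz (rExp p).toReal) μ
            (fun ω => formNorm 𝕂 p fun j => γ j ω * c j) ∧
        luxemburgNorm (expOrlicz (rExp p).toReal) μ
            (fun ω => formNorm 𝕂 p fun j => γ j ω * c j) ≤
          ENNReal.ofReal (B * (n : ℝ) ^ (1 / (rExp p).toReal + ∑ i, dimExp (p i)))) := by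
  refine ⟨fun r s M hr hs hM => ⟨upperConst r s M, upperConst_pos hs hM, ?_⟩, ?_⟩
  · intro m p hp hp1 hpr n hn 𝕂 _ Ω _ μ _ γ c hγ hind hsub hbd
    exact luxemburgNorm_formNorm_le hr hp hp1 hpr hn hs hM hγ hind hsub hbd
  · intro m p hp hp1
    obtain ⟨a, ha, hmom⟩ := exists_pos_le_lintegral_enorm
    have hm : 0 < m := hp1.choose.pos
    have hr := two_le_toReal_rExp hp hp1
    have hlm : 0 ≤ Real.log m := Real.log_natCast_nonneg m
    have hC := upperConst_pos (r := (rExp p).toReal) zero_le_one zero_le_one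
    have hm0 : (0 : ℝ) < m := by exact_mod_cast hm
    set C := upperConst (rExp p).toReal 1 1
    set R := 1 / (rExp p).toReal
    -- The factor `m ^ R` in `B` comes from `∑ n_i = m n`.
    refine ⟨a * (1 / 4 * (1 / 8) ^ m), C * (1 + Real.log m) ^ R * (m : ℝ) ^ R,
      by positivity, by positivity, ?_⟩
    intro n hn 𝕂 _ Ω _ μ _ γ c hind hlaw hc
    have hn0 : (0 : ℝ) < n := by exact_mod_cast hn
    have hγ : ∀ j, AEMeasurable (γ j) μ := fun j => by
      rcases hlaw j with h | h | ⟨-, h | h⟩ <;> exact h.aemeasurable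
    refine ⟨le_luxemburgNorm_formNorm hn hp hp1 ha hγ (fun j => hmom Ω μ (γ j) ?_) hc, ?_⟩
    · rcases hlaw j with h | h | ⟨-, h | h⟩ <;> simp only [h, true_or, or_true]
    have hsub : ∀ j, IsSubgaussianWith (γ j) 1 μ := fun j => by
      rcases hlaw j with h | h | ⟨-, h | h⟩
      · exact isSubgaussianWith_of_hasLaw h isSubgaussianWith_rademacherLaw
      · exact isSubgaussianWith_of_hasLaw h isSubgaussianWith_steinhausLaw
      · exact isSubgaussianWith_of_hasLaw h isSubgaussianWith_realGaussianLaw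
      · exact isSubgaussianWith_of_hasLaw h isSubgaussianWith_complexGaussianLaw
    -- Gaussian variables are unbounded, but they are admitted only for `rExp p = 2`, where nothing
    -- is required.
    have hbd : 2 < (rExp p).toReal → ∀ j, ∀ᵐ ω ∂μ, ‖γ j ω‖ ≤ 1 := fun h2 j => by
      have hmeas : Measurable fun z : ℂ => ‖z‖ ≤ 1 :=
        measurableSet_setOfPred.1 (measurableSet_le measurable_norm measurable_const)
      rcases hlaw j with h | h | ⟨h, -⟩
      · exact (h.ae_iff hmeas).2 (ae_norm_eq_one_rademacherLaw.mono fun z hz => hz.le)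
      · exact (h.ae_iff hmeas).2 (ae_norm_eq_one_steinhausLaw.mono fun z hz => hz.le)
      · rw [h, ENNReal.toReal_ofNat] at h2
        exact absurd h2 (lt_irrefl _)
    refine (luxemburgNorm_formNorm_le (n := fun _ => n) hr hp hp1 rfl (fun _ => hn) zero_le_one
      zero_le_one hγ hind hsub hbd).trans (le_of_eq ?_)
    have : Nonempty (Fin n) := ⟨⟨0, hn⟩⟩
    have hsup : ⨆ j, ‖c j‖ = 1 := by simp only [hc, ciSup_const]
    have hsum : ∑ _i : Fin m, (n : ℝ) = m * n := by simp
    rw [hsup, hsum, Real.mul_rpow hm0.le hn0.le, Real.rpow_add hn0, Real.rpow_sum_of_pos hn0]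
    congr 1
    ring
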